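/- Let $d\ge 1$, let $\Omega\subset\mathbb{R}^d$ be open and bounded with boundary $\Gamma=\partial\Omega$, let $\sigma$ be the $(d-1)$-dimensional Hausdorff measure, and assume $\sigma(\Gamma)<\infty$. All functions are complex-valued; $L^2(\Gamma)=L^2(\Gamma,\sigma)$. Let $\beta\in L^\infty(\Gamma)$. For $u\in H^1(\Omega)$ let $\mathrm{Tr}(u)$ be the set of all $\varphi\in L^2(\Gamma)$ for which there is a sequence $(u_n)$ in $C(\overline\Omega)\cap H^1(\Omega)$ with $u_n\to u$ in $H^1(\Omega)$ and $u_n|_\Gamma\to\varphi$ in $L^2(\Gamma)$ (the approximative traces of $u$). For $u\in H^1(\Omega)$ with distributional Laplacian $\Delta u\in L^2(\Omega)$ and for $h\in L^2(\Gamma)$, write $\partial_\nu u=h$ if $\int_\Omega(\Delta u)\overline v+\int_\Omega\nabla u\cdot\overline{\nabla v}=\int_\Gamma h\overline v\,d\sigma$ for all $v\in C(\overline\Omega)\cap H^1(\Omega)$, and write $\partial_\nu u\in L^2(\Gamma)$ if such an $h$ exists. The Wentzell Laplacian $\Delta^W$ in $L^2(\Omega)\oplus L^2(\Gamma)$ is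 given by $$D(\Delta^W)=\{(u,\varphi)\in H^1(\Omega)\oplus L^2(\Gamma):\Delta u\in L^2(\Omega),\ \varphi\in\mathrm{Tr}(u),\ \partial_\nu u\in L^2(\Gamma)\},\qquad \Delta^W(u,\varphi)=(\Delta u,\,-\partial_\nu u-\beta\varphi).$$ Let $V=\{(u,\varphi)\in H^1(\Omega)\oplus L^2(\Gamma):\varphi\in\mathrm{Tr}(u)\}$ with the norm of $H^1(\Omega)\oplus L^2(\Gamma)$. **Theorem.** The part $\Delta^W_V$ of $\Delta^W$ in $V$ is a (single-valued, linear) operator in $V$ and generates a holomorphic $C_0$-semigroup on $V$, that is, a $C_0$-semigroup that, for some $\theta\in(0,\pi/2]$, has a holomorphic extension to the sector $\{z\neq 0:|\arg z|<\theta\}$ which is bounded on $\{z\ne 0: |\arg z|<\theta',\ |z|\le 1\}$ for every $\theta'\in(0,\theta)$. In this realisation the Wentzell condition holds in the sense of traces: explicitly, for $(u,\varphi)\in V$ one has $$(u,\varphi)\in D(\Delta^W_V)\iff \Delta u\in H^1(\Omega),\ \partial_\nu u\in L^2(\Gamma),\ -\partial_\nu u-\beta\varphi\in\mathrm{Tr}(\Delta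 u),$$ and $\Delta^W_V(u,\varphi)=(\Delta u,\,-\partial_\nu u-\beta\varphi)$ for all $(u,\varphi)\in D(\Delta^W_V)$. -/

import Mathlib

open MeasureTheory Filter Topology
open scoped ContDiff

/-! ## Holomorphic `C₀`-semigroups and their generators -/

namespace Semigroup

variable {X : Type*} [NormedAddCommGroup X] [NormedSpace ℂ X]

/-- A strongly continuous one-parameter semigroup of bounded operators on `X`.
Only the values `S t` with `t ≥ 0` are relevant. -/
structure IsC0Semigroup (S : ℝ → X →L[ℂ] X) : Prop where
  map_zero : S 0 = ContinuousLinearMap.id ℂ X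
  map_add : ∀ s t : ℝ, 0 ≤ s → 0 ≤ t → S (s + t) = (S s).comp (S t)
  continuousOn : ∀ x : X, ContinuousOn (fun t : ℝ => S t x) (Set.Ici 0)

/-- The open sector `{z ∈ ℂ ∖ {0} : |arg z| < θ}`. -/
def sector (θ : ℝ) : Set ℂ := {z | z ≠ 0 ∧ |Complex.arg z| < θ}

/-- `S` extends to a holomorphic operator-valued function on some open sector of half-angle
`θ ∈ (0, π/2]`, and the extension is bounded on the part of every strictly smaller sector that lies
in the closed unit disc. -/
def HasHolomorphicExtension (S : ℝ → X →L[ℂ] X) : Prop :=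
  ∃ θ : ℝ, 0 < θ ∧ θ ≤ Real.pi / 2 ∧ ∃ T : ℂ → X →L[ℂ] X,
    DifferentiableOn ℂ T (sector θ) ∧
    (∀ t : ℝ, 0 < t → T (t : ℂ) = S t) ∧
    ∀ θ' : ℝ, 0 < θ' → θ' < θ → ∃ M : ℝ, ∀ z ∈ sector θ', ‖z‖ ≤ 1 → ‖T z‖ ≤ M

/-- The (unbounded) operator `A` is the generator of `S`: one has `x ∈ D(A)` and `A x = y` if and
only if `(S t x - x) / t → y` as `t ↓ 0`. -/
def IsGenerator (A : X →ₗ.[ℂ] X) (S : ℝ → X →L[ℂ] X) : Prop :=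
  ∀ x y : X, (x, y) ∈ A.graph ↔
    Tendsto (fun t : ℝ => ((t : ℂ)⁻¹) • (S t x - x)) (𝓝[>] (0 : ℝ)) (𝓝 y)

/-- The operator `A` generates a holomorphic `C₀`-semigroup on `X`. -/
def GeneratesHolomorphicC0Semigroup (A : X →ₗ.[ℂ] X) : Prop :=
  ∃ S : ℝ → X →L[ℂ] X, IsC0Semigroup S ∧ HasHolomorphicExtension S ∧ IsGenerator A S

end Semigroup

/-- The graph of the part in `Y` of the operator in `X` with graph `G`, where `Y` is a subspace of
`X` by means of the injection `ι : Y → X`: one has `x ∈ Y` in the domain, with image `y`, if and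
only if `x` belongs to the domain of the given operator and its image is the element `y` of `Y`. -/
def partGraph {X Y : Type*} (ι : Y → X) (G : Set (X × X)) : Set (Y × Y) :=
  {p | (ι p.1, ι p.2) ∈ G}

namespace Wentzell

noncomputable section

variable {d : ℕ}

/-- `L²(Ω)`, complex-valued, with respect to Lebesgue measure. -/
abbrev L2Dom (Ω : Set (EuclideanSpace ℝ (Fin d))) : Type :=
  Lp ℂ 2 (volume.restrict Ω)

/-- `L²(Ω; ℂᵈ)`. -/
abbrev L2Vec (Ω : Set (EuclideanSpace ℝ (Fin d))) : Type :=
  Lp (EuclideanSpace ℂ (Fin d)) 2 (volume.restrict Ω)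

/-- The `(d-1)`-dimensional Hausdorff measure `σ` (normalised so as to be the usual surface measure)
on the topological boundary `Γ` of `Ω`. -/
abbrev bdryMeasure (Ω : Set (EuclideanSpace ℝ (Fin d))) : Measure (EuclideanSpace ℝ (Fin d)) :=
  (Measure.euclideanHausdorffMeasure (d - 1)).restrict (frontier Ω)

/-- `L²(Γ) = L²(Γ, σ)`, complex-valued. -/
abbrev L2Bdry (Ω : Set (EuclideanSpace ℝ (Fin d))) : Type :=
  Lp ℂ 2 (bdryMeasure Ω)

/-- `L^∞(Γ) = L^∞(Γ, σ)`, complex-valued. -/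
abbrev LinftyBdry (Ω : Set (EuclideanSpace ℝ (Fin d))) : Type :=
  Lp ℂ ⊤ (bdryMeasure Ω)

/-- Test functions on `Ω`: complex-valued smooth functions with compact support in `Ω`. -/
structure IsTestFunction (Ω : Set (EuclideanSpace ℝ (Fin d)))
    (η : EuclideanSpace ℝ (Fin d) → ℂ) : Prop where
  contDiff : ContDiff ℝ ∞ η
  hasCompactSupport : HasCompactSupport η
  tsupport_subset : tsupport η ⊆ Ω

/-- The `i`-th classical partial derivative. -/
def partialDeriv (i : Fin d) (η : EuclideanSpace ℝ (Fin d) → ℂ) (x : EuclideanSpace ℝ (Fin d)) :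
    ℂ :=
  fderiv ℝ η x (EuclideanSpace.single i 1)

/-- `g ∈ L²(Ω; ℂᵈ)` is the weak gradient of `u ∈ L²(Ω)`. -/
def IsWeakGradient {Ω : Set (EuclideanSpace ℝ (Fin d))} (u : L2Dom Ω) (g : L2Vec Ω) : Prop :=
  ∀ η : EuclideanSpace ℝ (Fin d) → ℂ, IsTestFunction Ω η → ∀ i : Fin d,
    ∫ x in Ω, u x * partialDeriv i η x = -∫ x in Ω, g x i * η x

theorem IsTestFunction.memLp {Ω : Set (EuclideanSpace ℝ (Fin d))}
    {η : EuclideanSpace ℝ (Fin d) → ℂ} (hη : IsTestFunction Ω η) :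
    MemLp η 2 (volume.restrict Ω) :=
  (hη.contDiff.continuous.memLp_of_hasCompactSupport hη.hasCompactSupport).restrict Ω

theorem IsTestFunction.memLp_partialDeriv {Ω : Set (EuclideanSpace ℝ (Fin d))}
    {η : EuclideanSpace ℝ (Fin d) → ℂ} (hη : IsTestFunction Ω η) (i : Fin d) :
    MemLp (partialDeriv i η) 2 (volume.restrict Ω) := by
  have hc : Continuous (partialDeriv i η) :=
    (hη.contDiff.continuous_fderiv (by simp)).clm_apply continuous_const
  have hs : HasCompactSupport (partialDeriv i η) := hη.hasCompactSupport.fderiv_apply ℝ _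
  exact (hc.memLp_of_hasCompactSupport hs).restrict Ω

theorem memLp_coord {Ω : Set (EuclideanSpace ℝ (Fin d))} (g : L2Vec Ω) (i : Fin d) :
    MemLp (fun x => g x i) 2 (volume.restrict Ω) :=
  (Lp.memLp g).continuousLinearMap_comp (EuclideanSpace.proj (𝕜 := ℂ) i)

/-- The Sobolev space `H¹(Ω)` as a subspace of `L²(Ω) ⊕ L²(Ω; ℂᵈ)`. A function `u ∈ H¹(Ω)` is stored together with its weak gradient, so
that the norm of `L²(Ω) ⊕ L²(Ω; ℂᵈ)` restricts to the norm of `H¹(Ω)`. -/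
def H1Submodule (Ω : Set (EuclideanSpace ℝ (Fin d))) :
    Submodule ℂ (WithLp 2 (L2Dom Ω × L2Vec Ω)) where
  carrier := {p | IsWeakGradient p.fst p.snd}
  zero_mem' := by
    intro η _ i
    have e1 : ∫ x in Ω, ((0 : L2Dom Ω) x) * partialDeriv i η x = 0 := by
      apply integral_eq_zero_of_ae
      filter_upwards [Lp.coeFn_zero ℂ 2 (volume.restrict Ω)] with x hx
      rw [hx]
      simp
    have e2 : ∫ x in Ω, ((0 : L2Vec Ω) x) i * η x = 0 := by
      apply integral_eq_zero_of_ae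
      filter_upwards [Lp.coeFn_zero (EuclideanSpace ℂ (Fin d)) 2 (volume.restrict Ω)] with x hx
      rw [hx]
      simp
    simp only [WithLp.zero_fst, WithLp.zero_snd]
    rw [e1, e2, neg_zero]
  add_mem' := by
    intro p q hp hq η hη i
    have e1 : ∫ x in Ω, (p.fst + q.fst) x * partialDeriv i η x
        = (∫ x in Ω, p.fst x * partialDeriv i η x) + ∫ x in Ω, q.fst x * partialDeriv i η x := by
      refine Eq.trans ?_ (integral_add
        ((Lp.memLp p.fst).integrable_mul (hη.memLp_partialDeriv i))
        ((Lp.memLp q.fst).integrable_mul (hη.memLp_partialDeriv i)))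
      apply integral_congr_ae
      filter_upwards [Lp.coeFn_add p.fst q.fst] with x hx
      rw [hx]
      simp only [Pi.add_apply]
      ring
    have e2 : ∫ x in Ω, (p.snd + q.snd) x i * η x
        = (∫ x in Ω, p.snd x i * η x) + ∫ x in Ω, q.snd x i * η x := by
      refine Eq.trans ?_ (integral_add
        ((memLp_coord p.snd i).integrable_mul hη.memLp)
        ((memLp_coord q.snd i).integrable_mul hη.memLp))
      apply integral_congr_ae
      filter_upwards [Lp.coeFn_add p.snd q.snd] with x hx
      rw [hx]
      simp only [Pi.add_apply, PiLp.add_apply]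
      ring
    simp only [WithLp.add_fst, WithLp.add_snd]
    rw [e1, e2, hp η hη i, hq η hη i]
    ring
  smul_mem' := by
    intro c p hp η hη i
    have e1 : ∫ x in Ω, (c • p.fst) x * partialDeriv i η x
        = c * ∫ x in Ω, p.fst x * partialDeriv i η x := by
      rw [← integral_const_mul]
      apply integral_congr_ae
      filter_upwards [Lp.coeFn_smul c p.fst] with x hx
      simp [hx, mul_assoc]
    have e2 : ∫ x in Ω, (c • p.snd) x i * η x = c * ∫ x in Ω, p.snd x i * η x := by
      rw [← integral_const_mul]
      apply integral_congr_ae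
      filter_upwards [Lp.coeFn_smul c p.snd] with x hx
      simp [hx, mul_assoc]
    simp only [WithLp.smul_fst, WithLp.smul_snd]
    rw [e1, e2, hp η hη i]
    ring

/-- The Sobolev space `H¹(Ω)`, with norm `(‖u‖² + ‖∇u‖²)^(1/2)`. -/
abbrev H1 (Ω : Set (EuclideanSpace ℝ (Fin d))) : Type := ↥(H1Submodule Ω)

instance (Ω : Set (EuclideanSpace ℝ (Fin d))) : NormedAddCommGroup (H1 Ω) :=
  Submodule.normedAddCommGroup (H1Submodule Ω)

instance (Ω : Set (EuclideanSpace ℝ (Fin d))) : NormedSpace ℂ (H1 Ω) :=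
  Submodule.normedSpace (H1Submodule Ω)

/-- The element of `L²(Ω)` underlying an element of `H¹(Ω)`. -/
def H1.fn {Ω : Set (EuclideanSpace ℝ (Fin d))} (u : H1 Ω) : L2Dom Ω := u.1.fst

/-- The weak gradient of an element of `H¹(Ω)`. -/
def H1.grad {Ω : Set (EuclideanSpace ℝ (Fin d))} (u : H1 Ω) : L2Vec Ω := u.1.snd

/-- `Δu = f` in the sense of distributions on `Ω`, for `u, f ∈ L²(Ω)`. -/
def HasWeakLaplacian {Ω : Set (EuclideanSpace ℝ (Fin d))} (u f : L2Dom Ω) : Prop :=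
  ∀ η : EuclideanSpace ℝ (Fin d) → ℂ, IsTestFunction Ω η →
    ∫ x in Ω, u x * Laplacian.laplacian η x = ∫ x in Ω, f x * η x

/-- The function `v` (only its values on the closure of `Ω` matter) belongs to
`C(closure Ω) ∩ H¹(Ω)`, and `w` is the corresponding element of `H¹(Ω)`. -/
structure IsContH1 {Ω : Set (EuclideanSpace ℝ (Fin d))} (v : EuclideanSpace ℝ (Fin d) → ℂ)
    (w : H1 Ω) : Prop where
  continuousOn : ContinuousOn v (closure Ω)
  ae_eq : w.fn =ᵐ[volume.restrict Ω] v

/-- The set `Tr(u)` of all approximative traces of `u ∈ H¹(Ω)`: those `φ ∈ L²(Γ)` for which there is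
a sequence `vₙ ∈ C(closure Ω) ∩ H¹(Ω)` such that `vₙ → u` in `H¹(Ω)` and `vₙ|_Γ → φ` in
`L²(Γ)`. Here `wₙ` is the element of `H¹(Ω)` and `ψₙ` is the element of `L²(Γ)` given by `vₙ`. -/
def Tr {Ω : Set (EuclideanSpace ℝ (Fin d))} (u : H1 Ω) : Set (L2Bdry Ω) :=
  {φ | ∃ (v : ℕ → EuclideanSpace ℝ (Fin d) → ℂ) (w : ℕ → H1 Ω) (ψ : ℕ → L2Bdry Ω),
    (∀ n, IsContH1 (v n) (w n)) ∧ (∀ n, ψ n =ᵐ[bdryMeasure Ω] v n) ∧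
    Tendsto w atTop (𝓝 u) ∧ Tendsto ψ atTop (𝓝 φ)}

/-- `∂_ν u = h` for `u ∈ H¹(Ω)` with `Δu ∈ L²(Ω)` and `h ∈ L²(Γ)`, in the sense of
Green's formula. In particular this includes the assertion that `Δu ∈ L²(Ω)`. -/
def HasNormalDeriv {Ω : Set (EuclideanSpace ℝ (Fin d))} (u : H1 Ω) (h : L2Bdry Ω) : Prop :=
  ∃ f : L2Dom Ω, HasWeakLaplacian u.fn f ∧
    ∀ (v : EuclideanSpace ℝ (Fin d) → ℂ) (w : H1 Ω), IsContH1 v w →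
      (∫ x in Ω, f x * starRingEnd ℂ (v x)) +
        (∫ x in Ω, ∑ i : Fin d, u.grad x i * starRingEnd ℂ (w.grad x i)) =
      ∫ z, h z * starRingEnd ℂ (v z) ∂(bdryMeasure Ω)

/-- The Hilbert space `L²(Ω) ⊕ L²(Γ)`. -/
abbrev L2Sum (Ω : Set (EuclideanSpace ℝ (Fin d))) : Type :=
  WithLp 2 (L2Dom Ω × L2Bdry Ω)

/-- The (graph of the) Wentzell Laplacian `Δ^W` in `L²(Ω) ⊕ L²(Γ)`. A pair `(p, q)` belongs to it
if and only if `p = (u, φ)` with `u ∈ H¹(Ω)`, `Δu ∈ L²(Ω)`, `φ ∈ Tr(u)`,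
`∂_ν u ∈ L²(Γ)`, and `q = (Δu, -∂_ν u - β φ)`. -/
def wentzellLaplacian (Ω : Set (EuclideanSpace ℝ (Fin d))) (β : LinftyBdry Ω) :
    Set (L2Sum Ω × L2Sum Ω) :=
  {pq | ∃ (u : H1 Ω) (h : L2Bdry Ω), u.fn = pq.1.fst ∧ pq.1.snd ∈ Tr u ∧
    HasWeakLaplacian u.fn pq.2.fst ∧ HasNormalDeriv u h ∧
    pq.2.snd = -h - (β • pq.1.snd : L2Bdry Ω)}

/-- The subspace `V = {(u, φ) : φ ∈ Tr(u)}` of `H¹(Ω) ⊕ L²(Γ)`, as a submodule. -/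
def VSubmodule (Ω : Set (EuclideanSpace ℝ (Fin d))) :
    Submodule ℂ (WithLp 2 (H1 Ω × L2Bdry Ω)) where
  carrier := {p | p.snd ∈ Tr p.fst}
  zero_mem' := by
    refine ⟨fun _ _ => 0, fun _ => 0, fun _ => 0, fun _ => ⟨continuousOn_const, ?_⟩, fun _ => ?_,
      tendsto_const_nhds, tendsto_const_nhds⟩
    · exact Lp.coeFn_zero _ _ _
    · exact Lp.coeFn_zero _ _ _
  add_mem' := by
    rintro p q ⟨v, w, ψ, h1, h2, h3, h4⟩ ⟨v', w', ψ', h1', h2', h3', h4'⟩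
    refine ⟨fun n => v n + v' n, fun n => w n + w' n, fun n => ψ n + ψ' n,
      fun n => ⟨(h1 n).continuousOn.add (h1' n).continuousOn, ?_⟩, fun n => ?_,
      h3.add h3', h4.add h4'⟩
    · exact (Lp.coeFn_add _ _).trans ((h1 n).ae_eq.add (h1' n).ae_eq)
    · exact (Lp.coeFn_add _ _).trans ((h2 n).add (h2' n))
  smul_mem' := by
    rintro c p ⟨v, w, ψ, h1, h2, h3, h4⟩
    refine ⟨fun n => c • v n, fun n => c • w n, fun n => c • ψ n,
      fun n => ⟨(h1 n).continuousOn.const_smul c, ?_⟩, fun n => ?_,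
      h3.const_smul c, h4.const_smul c⟩
    · exact (Lp.coeFn_smul _ _).trans ((h1 n).ae_eq.const_smul c)
    · exact (Lp.coeFn_smul _ _).trans ((h2 n).const_smul c)

/-- The space `V`, with the norm induced by `H¹(Ω) ⊕ L²(Γ)`. -/
abbrev V (Ω : Set (EuclideanSpace ℝ (Fin d))) : Type := ↥(VSubmodule Ω)

instance (Ω : Set (EuclideanSpace ℝ (Fin d))) : NormedAddCommGroup (V Ω) :=
  Submodule.normedAddCommGroup (VSubmodule Ω)

instance (Ω : Set (EuclideanSpace ℝ (Fin d))) : NormedSpace ℂ (V Ω) :=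
  Submodule.normedSpace (VSubmodule Ω)

/-- The component `u ∈ H¹(Ω)` of `(u, φ) ∈ V`. -/
def V.fn {Ω : Set (EuclideanSpace ℝ (Fin d))} (x : V Ω) : H1 Ω := x.1.fst

/-- The component `φ ∈ L²(Γ)` of `(u, φ) ∈ V`. -/
def V.bdry {Ω : Set (EuclideanSpace ℝ (Fin d))} (x : V Ω) : L2Bdry Ω := x.1.snd

/-- The natural injection of `V` into `L²(Ω) ⊕ L²(Γ)`. -/
def V.toL2Sum {Ω : Set (EuclideanSpace ℝ (Fin d))} (x : V Ω) : L2Sum Ω :=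
  WithLp.toLp 2 (x.fn.fn, x.bdry)

end

end Wentzell

/-!
By Green's identity, `y = Δ^W x` in `V` says exactly that
`⟪v, x⟫_V = ⟪ι v, B x⟫_H - ⟪ι v, ι y⟫_H` for all `v ∈ V`, where `H = L²(Ω) ⊕ L²(Γ)`, `ι : V → H` is
the inclusion and `B (u, φ) = (u, φ - β φ)`. For any bounded `ι, B : V → H` with `ι` injective, such
a relation defines a generator `A` on `V`: the form `⟪v, x⟫ - ⟪ι v, B x⟫ + ‖B‖² ⟪ι v, ι x⟫` is
coercive on `V`, hence represented by an invertible `Q`, and `‖B‖² - A` is the inverse of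
`M = Q⁻¹ ι† ι`. The numerical range of `M` lies in a sector around the positive half-line strictly
smaller than the right half-plane, and its range is dense. The bounded operators `(M + ε)⁻¹` have
their numerical ranges in the same sector, so that `exp (-z (M + ε)⁻¹)` is contractive for `z` in
the complementary sector; as `ε ↓ 0` these exponentials converge strongly to the semigroup
generated by `-M⁻¹`.
-/

namespace HolomorphicSemigroup

section StrongHolomorphy

open Metric

variable {E F : Type*} [NormedAddCommGroup E] [NormedSpace ℂ E]
  [NormedAddCommGroup F] [NormedSpace ℂ F]

theorem norm_deriv_le_of_forall_norm_le {f : ℂ → F} {c : ℂ} {r C : ℝ} (hr : 0 < r)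
    (hf : DifferentiableOn ℂ f (ball c r)) (hC : ∀ z ∈ ball c r, ‖f z‖ ≤ C) :
    ‖deriv f c‖ ≤ 2 * C / r := by
  refine Complex.norm_deriv_le_div_of_mapsTo_ball hf (fun z hz => ?_) hr
  rw [mem_closedBall, dist_eq_norm]
  linarith [norm_sub_le (f z) (f c), hC z hz, hC c (mem_ball_self hr)]

/-- The Schwarz lemma, applied to the first order Taylor remainder. -/
theorem norm_sub_sub_smul_deriv_le {f : ℂ → F} {c : ℂ} {r C : ℝ}
    (hf : DifferentiableOn ℂ f (ball c r)) (hC : ∀ z ∈ ball c r, ‖f z‖ ≤ C) {z : ℂ}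
    (hz : z ∈ ball c r) :
    ‖f z - f c - (z - c) • deriv f c‖ ≤ 4 * C * (‖z - c‖ / r) ^ 2 := by
  have hr : 0 < r := pos_of_mem_ball hz
  have hc : c ∈ ball c r := mem_ball_self hr
  set g : ℂ → F := fun w => f w - (w - c) • deriv f c
  have hg_sub (w : ℂ) : g w - g c = f w - f c - (w - c) • deriv f c := by
    simp only [g, sub_self, zero_smul, sub_zero]
    abel
  have hg_maps : Set.MapsTo g (ball c r) (closedBall (g c) (4 * C)) := by
    intro w hw
    have hsmul : ‖(w - c) • deriv f c‖ ≤ 2 * C := by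
      calc ‖(w - c) • deriv f c‖ ≤ r * (2 * C / r) := by
            rw [norm_smul, ← dist_eq_norm]
            exact mul_le_mul (mem_ball.1 hw).le (norm_deriv_le_of_forall_norm_le hr hf hC)
              (norm_nonneg _) hr.le
        _ = 2 * C := mul_div_cancel₀ _ hr.ne'
    rw [mem_closedBall, dist_eq_norm, hg_sub]
    linarith [norm_sub_le (f w - f c) ((w - c) • deriv f c), norm_sub_le (f w) (f c), hC w hw,
      hC c hc]
  have hg_littleO : (g · - g c) =o[𝓝 c] fun w => ‖w - c‖ ^ 1 := by
    simpa only [hg_sub, pow_one] using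
      (hasDerivAt_iff_isLittleO.1 (hf.differentiableAt (ball_mem_nhds c hr)).hasDerivAt).norm_right
  have hg_diff : DifferentiableOn ℂ g (ball c r) :=
    hf.sub ((differentiableOn_id.sub_const c).smul_const _)
  simpa only [dist_eq_norm, hg_sub, Nat.reduceAdd] using
    Complex.dist_le_mul_div_pow_of_mapsTo_ball_of_isLittleO hg_diff hg_maps hg_littleO hz

/-- A bounded family of operators that is holomorphic for the strong operator topology is
holomorphic for the operator norm. -/
theorem differentiableOn_of_forall_apply {U : Set ℂ} (hU : IsOpen U) {T : ℂ → E →L[ℂ] F} {C : ℝ}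
    (hC : ∀ z ∈ U, ‖T z‖ ≤ C) (hT : ∀ x, DifferentiableOn ℂ (fun z => T z x) U) :
    DifferentiableOn ℂ T U := by
  intro c hcU
  obtain ⟨r, hr, hrU⟩ := Metric.isOpen_iff.1 hU c hcU
  have hT_ball (x : E) : DifferentiableOn ℂ (fun z => T z x) (ball c r) := (hT x).mono hrU
  have hT_at (x : E) : DifferentiableAt ℂ (fun z => T z x) c :=
    (hT_ball x).differentiableAt (ball_mem_nhds c hr)
  have hT_le (x : E) (z : ℂ) (hz : z ∈ ball c r) : ‖T z x‖ ≤ C * ‖x‖ :=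
    (T z).le_of_opNorm_le (hC z (hrU hz)) x
  let D : E →L[ℂ] F := LinearMap.mkContinuous
    { toFun := fun x => deriv (fun z => T z x) c
      map_add' := fun x y => by simpa only [map_add] using deriv_fun_add (hT_at x) (hT_at y)
      map_smul' := fun a x => by
        simpa only [map_smul, RingHom.id_apply] using deriv_fun_const_smul a (hT_at x) }
    (2 * C / r) fun x => (norm_deriv_le_of_forall_norm_le hr (hT_ball x) (hT_le x)).trans_eq
      (by ring)
  have hbound : ∀ z ∈ ball c r, ‖T z - T c - (z - c) • D‖ ≤ 4 * C / r ^ 2 * ‖‖z - c‖ ^ 2‖ := by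
    intro z hz
    have hC0 : 0 ≤ C := (norm_nonneg _).trans (hC c hcU)
    refine ContinuousLinearMap.opNorm_le_bound _ (by positivity) fun x => ?_
    calc ‖(T z - T c - (z - c) • D) x‖ ≤ 4 * (C * ‖x‖) * (‖z - c‖ / r) ^ 2 :=
          norm_sub_sub_smul_deriv_le (hT_ball x) (hT_le x) hz
      _ = 4 * C / r ^ 2 * ‖‖z - c‖ ^ 2‖ * ‖x‖ := by rw [norm_pow, norm_norm]; ring
  have hbigO : (fun z => T z - T c - (z - c) • D) =O[𝓝 c] fun z => ‖z - c‖ ^ 2 :=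
    .of_bound _ (eventually_of_mem (ball_mem_nhds c hr) hbound)
  have hderiv : HasDerivAt T D c := hasDerivAt_iff_isLittleO.2
    (hbigO.trans_isLittleO (Asymptotics.isLittleO_pow_sub_sub c one_lt_two))
  exact hderiv.differentiableAt.differentiableWithinAt

end StrongHolomorphy

open NormedSpace (exp)

section OperatorExp

variable {E : Type*} [NormedAddCommGroup E] [NormedSpace ℂ E]

theorem hasDerivAt_comp_ofReal {f : ℂ → E} {f' : E} {t : ℝ} (hf : HasDerivAt f f' (t : ℂ)) :
    HasDerivAt (fun s : ℝ => f s) f' t := by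
  simpa only [Complex.ofRealCLM_apply, Complex.ofReal_one, one_smul] using!
    hf.scomp t Complex.ofRealCLM.hasDerivAt

variable [CompleteSpace E]

theorem hasDerivAt_exp_smul_apply (B : E →L[ℂ] E) (x : E) (z : ℂ) :
    HasDerivAt (fun w : ℂ => exp (w • B) x) (B (exp (z • B) x)) z :=
  (ContinuousLinearMap.apply ℂ E x).hasFDerivAt.comp_hasDerivAt z (hasDerivAt_exp_smul_const' B z)

theorem exp_add_apply_of_commute {B C : E →L[ℂ] E} (h : Commute B C) (x : E) :
    exp (B + C) x = exp B (exp C x) := by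
  let : NormedAlgebra ℚ (E →L[ℂ] E) := NormedAlgebra.restrictScalars ℚ ℂ _
  rw [NormedSpace.exp_add_of_commute h, ContinuousLinearMap.mul_def,
    ContinuousLinearMap.comp_apply]

end OperatorExp

variable {X : Type*} [NormedAddCommGroup X] [InnerProductSpace ℂ X]

section Accretive

/-- A bounded operator on a complex inner product space is accretive if its numerical range lies in
the closed right half-plane. -/
def Accretive (B : X →L[ℂ] X) : Prop := ∀ x, 0 ≤ (inner ℂ (B x) x).re

theorem Accretive.add {B C : X →L[ℂ] X} (hB : Accretive B) (hC : Accretive C) :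
    Accretive (B + C) := fun x => by
  simpa only [add_apply, inner_add_left, Complex.add_re] using add_nonneg (hB x) (hC x)

theorem Accretive.ofReal_smul {B : X →L[ℂ] X} (hB : Accretive B) {t : ℝ} (ht : 0 ≤ t) :
    Accretive ((t : ℂ) • B) := fun x => by
  simpa only [smul_apply, inner_smul_left, Complex.conj_ofReal, Complex.re_ofReal_mul]
    using mul_nonneg ht (hB x)

variable [CompleteSpace X]

theorem Accretive.norm_exp_neg_apply_le {B : X →L[ℂ] X} (hB : Accretive B) (x : X) :
    ‖exp (-B) x‖ ≤ ‖x‖ := by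
  let : InnerProductSpace ℝ X := InnerProductSpace.rclikeToReal ℂ X
  have hderiv (t : ℝ) : HasDerivAt (fun s : ℝ => ‖exp ((s : ℂ) • -B) x‖ ^ 2)
      (2 * inner ℝ (exp ((t : ℂ) • -B) x) ((-B) (exp ((t : ℂ) • -B) x))) t :=
    (hasDerivAt_comp_ofReal (hasDerivAt_exp_smul_apply (-B) x t)).norm_sq
  have hanti : Antitone fun s : ℝ => ‖exp ((s : ℂ) • -B) x‖ ^ 2 := by
    refine antitone_of_deriv_nonpos (fun t => (hderiv t).differentiableAt) fun t => ?_
    have hre := hB (exp ((t : ℂ) • -B) x)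
    rw [(hderiv t).deriv, real_inner_comm, neg_apply, inner_neg_left, real_inner_eq_re_inner ℂ,
      RCLike.re_eq_complex_re]
    linarith
  refine le_of_sq_le_sq ?_ (norm_nonneg x)
  simpa using hanti zero_le_one

/-- The difference is the integral of `exp (-(s P + (1 - s) Q)) (Q x - P x)` over `s ∈ [0, 1]`. -/
theorem Accretive.norm_exp_neg_sub_le {P Q : X →L[ℂ] X} (hP : Accretive P) (hQ : Accretive Q)
    (hPQ : Commute P Q) (x : X) : ‖exp (-P) x - exp (-Q) x‖ ≤ ‖P x - Q x‖ := by
  set g : ℝ → X := fun s => exp ((s : ℂ) • (Q - P)) (exp (-Q) x)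
  have hcomm : Commute (Q - P) Q := (Commute.refl Q).sub_left hPQ
  have hg (s : ℝ) : g s = exp (-((s : ℂ) • P + ((1 - s : ℝ) : ℂ) • Q)) x := by
    refine (exp_add_apply_of_commute (hcomm.smul_left _).neg_right x).symm.trans ?_
    congr 2
    push_cast
    module
  have hderiv (s : ℝ) : HasDerivAt g
      (exp (-((s : ℂ) • P + ((1 - s : ℝ) : ℂ) • Q)) (Q x - P x)) s := by
    refine (hasDerivAt_comp_ofReal
      (hasDerivAt_exp_smul_apply (Q - P) (exp (-Q) x) s)).congr_deriv ?_
    have hcomm_exp : Commute (Q - P) (exp (-((s : ℂ) • P + ((1 - s : ℝ) : ℂ) • Q))) :=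
      (((hPQ.symm.sub_left (Commute.refl P)).smul_right _).add_right
        (hcomm.smul_right _)).neg_right.exp_right
    exact (congrArg (Q - P) (hg s)).trans (DFunLike.congr_fun hcomm_exp x)
  have hbound : ∀ s ∈ Set.Ico (0 : ℝ) 1,
      ‖exp (-((s : ℂ) • P + ((1 - s : ℝ) : ℂ) • Q)) (Q x - P x)‖ ≤ ‖P x - Q x‖ := by
    intro s hs
    rw [norm_sub_rev (P x)]
    have hPQ_acc := (hP.ofReal_smul hs.1).add (hQ.ofReal_smul (sub_nonneg.2 hs.2.le))
    exact hPQ_acc.norm_exp_neg_apply_le _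
  simpa [hg] using norm_image_sub_le_of_norm_deriv_le_segment_01'
    (fun s _ => (hderiv s).hasDerivWithinAt) hbound

theorem isUnit_of_mul_norm_sq_le_re_inner {B : X →L[ℂ] X} {ε : ℝ} (hε : 0 < ε)
    (h : ∀ x, ε * ‖x‖ ^ 2 ≤ (inner ℂ (B x) x).re) : IsUnit B := by
  refine ContinuousLinearMap.isUnit_of_forall_le_norm_inner_map B (c := ⟨ε, hε.le⟩) hε fun x => ?_
  rw [mul_comm]
  exact (h x).trans (Complex.re_le_norm _)

end Accretive

open scoped NNReal

section Cone

/-- The closed sector of half-angle `arctan c` around the positive real axis. -/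
def cone (c : ℝ≥0) : Set ℂ := {z | 0 ≤ z.re ∧ |z.im| ≤ c * z.re}

theorem ofReal_mem_cone (c : ℝ≥0) {t : ℝ} (ht : 0 ≤ t) : (t : ℂ) ∈ cone c :=
  ⟨by simpa using ht, by simpa using mul_nonneg c.coe_nonneg ht⟩

theorem zero_mem_cone (c : ℝ≥0) : (0 : ℂ) ∈ cone c := ofReal_mem_cone c le_rfl

theorem add_mem_cone {c : ℝ≥0} {z w : ℂ} (hz : z ∈ cone c) (hw : w ∈ cone c) : z + w ∈ cone c := by
  refine ⟨add_nonneg hz.1 hw.1, (abs_add_le _ _).trans ?_⟩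
  rw [Complex.add_re, mul_add]
  exact add_le_add hz.2 hw.2

theorem sector_arctan_subset_cone (c : ℝ≥0) : Semigroup.sector (Real.arctan c) ⊆ cone c := by
  rintro z ⟨hz, harg⟩
  have hre : 0 < z.re := (Complex.abs_arg_lt_pi_div_two_iff.1
    (harg.trans (Real.arctan_lt_pi_div_two c))).resolve_right hz
  refine ⟨hre.le, ?_⟩
  rw [← div_le_iff₀ hre, ← abs_of_pos hre, ← abs_div, ← Complex.tan_arg, abs_le]
  obtain ⟨hlower, hupper⟩ := abs_lt.1 harg
  have hc := Real.arctan_lt_pi_div_two c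
  constructor
  · rw [← Real.tan_arctan (c : ℝ), ← Real.tan_neg]
    exact (Real.tan_lt_tan_of_lt_of_lt_pi_div_two (by linarith) (by linarith) hlower).le
  · rw [← Real.tan_arctan (c : ℝ)]
    exact (Real.tan_lt_tan_of_lt_of_lt_pi_div_two (by linarith) hc hupper).le

theorem isOpen_sector {θ : ℝ} (hθ : θ ≤ Real.pi) : IsOpen (Semigroup.sector θ) := by
  refine isOpen_iff_mem_nhds.2 fun z ⟨hz, harg⟩ => ?_
  have hslit : z ∈ Complex.slitPlane :=
    Complex.mem_slitPlane_iff_arg.2 ⟨((le_abs_self _).trans_lt (harg.trans_le hθ)).ne, hz⟩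
  filter_upwards [isOpen_ne.mem_nhds hz,
    (Complex.continuousAt_arg hslit).abs.eventually_lt_const harg] with w hw hw_arg
  exact ⟨hw, hw_arg⟩

end Cone

section Sectorial

/-- A bounded operator on a complex inner product space is sectorial with constant `c` if its
numerical range lies in the sector `{m | c * |Im m| ≤ Re m}` of half-angle `π / 2 - arctan c`; then
its multiples by elements of `cone c` are accretive. -/
def Sectorial (c : ℝ≥0) (M : X →L[ℂ] X) : Prop :=
  ∀ x, c * |(inner ℂ (M x) x).im| ≤ (inner ℂ (M x) x).re

variable {c : ℝ≥0} {M : X →L[ℂ] X}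

theorem Sectorial.accretive (hM : Sectorial c M) : Accretive M := fun x =>
  (mul_nonneg c.coe_nonneg (abs_nonneg _)).trans (hM x)

theorem Sectorial.accretive_smul (hM : Sectorial c M) {z : ℂ} (hz : z ∈ cone c) :
    Accretive (z • M) := fun x => by
  set m := inner ℂ (M x) x
  have him : |z.im * m.im| ≤ z.re * m.re := by
    calc |z.im * m.im| = |z.im| * |m.im| := abs_mul _ _
      _ ≤ c * z.re * |m.im| := by gcongr; exact hz.2
      _ = z.re * (c * |m.im|) := by ring
      _ ≤ z.re * m.re := by gcongr; exacts [hz.1, hM x]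
  rw [smul_apply, inner_smul_left, Complex.mul_re, Complex.conj_re, Complex.conj_im]
  linarith [neg_abs_le (z.im * m.im)]

end Sectorial

section Yosida

theorem commute_ringInverse_right {R : Type*} [MonoidWithZero R] {a b : R} (h : Commute a b) :
    Commute a (Ring.inverse b) := by
  by_cases hb : IsUnit b
  · obtain ⟨u, rfl⟩ := hb
    rw [Ring.inverse_unit]
    exact h.units_inv_right
  · rw [Ring.inverse_non_unit _ hb]
    exact Commute.zero_right a

/-- The Yosida approximation `(M + ε)⁻¹` of the (possibly unbounded) inverse of `M`. -/
noncomputable def yosida (M : X →L[ℂ] X) (ε : ℝ) : X →L[ℂ] X :=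
  Ring.inverse (M + (ε : ℂ) • 1)

variable {M : X →L[ℂ] X} {ε : ℝ}

theorem commute_yosida (M : X →L[ℂ] X) (ε : ℝ) : Commute M (yosida M ε) :=
  commute_ringInverse_right ((Commute.refl M).add_right ((Commute.one_right M).smul_right _))

theorem yosida_apply_comm (M : X →L[ℂ] X) (ε : ℝ) (x : X) :
    yosida M ε (M x) = M (yosida M ε x) :=
  (DFunLike.congr_fun (commute_yosida M ε) x).symm

theorem commute_yosida_yosida (M : X →L[ℂ] X) (ε δ : ℝ) : Commute (yosida M ε) (yosida M δ) :=
  commute_ringInverse_right ((commute_yosida M ε).symm.add_right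
    ((Commute.one_right _).smul_right _))

theorem Accretive.norm_sq_add_norm_sq_le (hM : Accretive M) (hε : 0 ≤ ε) (x : X) :
    ‖M x‖ ^ 2 + (ε * ‖x‖) ^ 2 ≤ ‖M x + (ε : ℂ) • x‖ ^ 2 := by
  have hcross : 0 ≤ ε * (inner ℂ (M x) x).re := mul_nonneg hε (hM x)
  rw [@norm_add_sq ℂ, inner_smul_right, norm_smul, Complex.norm_real, Real.norm_of_nonneg hε,
    RCLike.re_eq_complex_re, Complex.re_ofReal_mul]
  linarith

variable [CompleteSpace X]

theorem Accretive.isUnit_add_smul_one (hM : Accretive M) (hε : 0 < ε) :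
    IsUnit (M + (ε : ℂ) • (1 : X →L[ℂ] X)) := by
  refine isUnit_of_mul_norm_sq_le_re_inner hε fun x => ?_
  rw [add_apply, smul_apply, one_apply_eq_self, inner_add_left, inner_smul_left,
    Complex.conj_ofReal, Complex.add_re, Complex.re_ofReal_mul, ← RCLike.re_eq_complex_re,
    inner_self_eq_norm_sq]
  exact le_add_of_nonneg_left (hM x)

theorem Accretive.apply_yosida_add (hM : Accretive M) (hε : 0 < ε) (x : X) :
    M (yosida M ε x) + (ε : ℂ) • yosida M ε x = x :=
  DFunLike.congr_fun (Ring.mul_inverse_cancel _ (hM.isUnit_add_smul_one hε)) x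

theorem Accretive.yosida_apply_add (hM : Accretive M) (hε : 0 < ε) (x : X) :
    yosida M ε (M x) + (ε : ℂ) • yosida M ε x = x := by
  rw [yosida_apply_comm]
  exact hM.apply_yosida_add hε x

theorem Accretive.mul_norm_yosida_le (hM : Accretive M) (hε : 0 < ε) (x : X) :
    ε * ‖yosida M ε x‖ ≤ ‖x‖ := by
  have h := hM.norm_sq_add_norm_sq_le hε.le (yosida M ε x)
  rw [hM.apply_yosida_add hε] at h
  exact le_of_sq_le_sq ((le_add_of_nonneg_left (sq_nonneg _)).trans h) (norm_nonneg x)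

theorem Accretive.norm_yosida_apply_le (hM : Accretive M) (hε : 0 < ε) (x : X) :
    ‖yosida M ε (M x)‖ ≤ ‖x‖ := by
  have h := hM.norm_sq_add_norm_sq_le hε.le (yosida M ε x)
  rw [hM.apply_yosida_add hε, ← yosida_apply_comm] at h
  exact le_of_sq_le_sq ((le_add_of_nonneg_right (sq_nonneg _)).trans h) (norm_nonneg x)

protected theorem Sectorial.yosida {c : ℝ≥0} (hM : Sectorial c M) (hε : 0 < ε) :
    Sectorial c (yosida M ε) := by
  intro x
  set y := yosida M ε x
  have hinner : inner ℂ y x = starRingEnd ℂ (inner ℂ (M y) y) + ((ε * ‖y‖ ^ 2 : ℝ) : ℂ) := by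
    rw [← hM.accretive.apply_yosida_add hε x, inner_add_right, inner_smul_right,
      inner_self_eq_norm_sq_to_K, inner_conj_symm]
    push_cast
    rfl
  rw [hinner, Complex.add_re, Complex.add_im, Complex.conj_re, Complex.conj_im, Complex.ofReal_re,
    Complex.ofReal_im, add_zero, abs_neg]
  exact (hM y).trans (le_add_of_nonneg_right (by positivity))

/-- The norm of `ε (M + ε)⁻¹ x` is at most `ε ‖v‖ + ‖x - M v‖`, and the range of `M` is dense. -/
theorem Accretive.tendsto_mul_norm_yosida (hM : Accretive M) (hd : DenseRange M) (x : X) :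
    Tendsto (fun ε => ε * ‖yosida M ε x‖) (𝓝[>] 0) (𝓝 0) := by
  refine Metric.tendsto_nhds.2 fun η hη => ?_
  obtain ⟨v, hv⟩ := hd.exists_dist_lt x (half_pos hη)
  have hsmall : ∀ᶠ ε in 𝓝[>] (0 : ℝ), ε * ‖v‖ < η / 2 := by
    have htendsto : Tendsto (fun ε : ℝ => ε * ‖v‖) (𝓝[>] 0) (𝓝 0) :=
      ((continuous_mul_const ‖v‖).tendsto' 0 0 (zero_mul _)).mono_left nhdsWithin_le_nhds
    exact htendsto.eventually_lt_const (half_pos hη)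
  filter_upwards [hsmall, self_mem_nhdsWithin] with ε hεv hε
  rw [dist_zero_right, Real.norm_of_nonneg (mul_nonneg (le_of_lt hε) (norm_nonneg _))]
  calc ε * ‖yosida M ε x‖ = ε * ‖yosida M ε (M v) + yosida M ε (x - M v)‖ := by
        rw [← map_add, add_sub_cancel]
    _ ≤ ε * ‖yosida M ε (M v)‖ + ε * ‖yosida M ε (x - M v)‖ := by
        rw [← mul_add]
        exact mul_le_mul_of_nonneg_left (norm_add_le _ _) (le_of_lt hε)
    _ ≤ ε * ‖v‖ + ‖x - M v‖ :=
        add_le_add (mul_le_mul_of_nonneg_left (hM.norm_yosida_apply_le hε v) (le_of_lt hε))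
          (hM.mul_norm_yosida_le hε _)
    _ < η := by
        rw [dist_eq_norm] at hv
        linarith

theorem Accretive.tendsto_yosida_apply (hM : Accretive M) (hd : DenseRange M) (x : X) :
    Tendsto (fun ε => yosida M ε (M x)) (𝓝[>] 0) (𝓝 x) := by
  refine tendsto_iff_norm_sub_tendsto_zero.2 ((hM.tendsto_mul_norm_yosida hd x).congr' ?_)
  filter_upwards [self_mem_nhdsWithin] with ε hε
  rw [← neg_sub, norm_neg, ← eq_sub_of_add_eq' (hM.yosida_apply_add hε x), norm_smul,
    Complex.norm_real, Real.norm_of_nonneg (le_of_lt hε)]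

theorem Accretive.injective (hM : Accretive M) (hd : DenseRange M) : Function.Injective M := by
  intro x y hxy
  refine tendsto_nhds_unique (hM.tendsto_yosida_apply hd x) ?_
  simpa only [hxy] using hM.tendsto_yosida_apply hd y

end Yosida

section YosidaExp

/-- The exponential `exp (-z (M + ε)⁻¹)`, which approximates `exp (-z M⁻¹)` as `ε ↓ 0`. -/
noncomputable def yosidaExp (M : X →L[ℂ] X) (ε : ℝ) (z : ℂ) : X →L[ℂ] X :=
  exp (z • -yosida M ε)

variable {c : ℝ≥0} {M : X →L[ℂ] X} {ε δ : ℝ} {z : ℂ}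

theorem yosidaExp_zero (M : X →L[ℂ] X) (ε : ℝ) : yosidaExp M ε 0 = 1 := by
  rw [yosidaExp, zero_smul, NormedSpace.exp_zero]

theorem yosidaExp_apply_comm {B : X →L[ℂ] X} (h : Commute B (yosida M ε)) (z : ℂ) (x : X) :
    yosidaExp M ε z (B x) = B (yosidaExp M ε z x) :=
  (DFunLike.congr_fun (h.neg_right.smul_right z).exp_right x).symm

variable [CompleteSpace X]

theorem yosidaExp_add_apply (M : X →L[ℂ] X) (ε : ℝ) (z w : ℂ) (x : X) :
    yosidaExp M ε (z + w) x = yosidaExp M ε z (yosidaExp M ε w x) := by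
  rw [yosidaExp, add_smul,
    exp_add_apply_of_commute (((Commute.refl _).smul_left z).smul_right w), yosidaExp, yosidaExp]

theorem hasDerivAt_yosidaExp_apply (M : X →L[ℂ] X) (ε : ℝ) (x : X) (z : ℂ) :
    HasDerivAt (fun w => yosidaExp M ε w x) (-yosidaExp M ε z (yosida M ε x)) z := by
  rw [yosidaExp_apply_comm (Commute.refl _)]
  exact hasDerivAt_exp_smul_apply (-yosida M ε) x z

theorem Sectorial.norm_yosidaExp_apply_le (hM : Sectorial c M) (hε : 0 < ε) (hz : z ∈ cone c)
    (x : X) : ‖yosidaExp M ε z x‖ ≤ ‖x‖ := by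
  rw [yosidaExp, smul_neg]
  exact ((hM.yosida hε).accretive_smul hz).norm_exp_neg_apply_le x

theorem Sectorial.norm_yosidaExp_sub_yosidaExp_le (hM : Sectorial c M) (hε : 0 < ε) (hδ : 0 < δ)
    (hz : z ∈ cone c) (x : X) :
    ‖yosidaExp M ε z x - yosidaExp M δ z x‖ ≤ ‖z‖ * ‖yosida M ε x - yosida M δ x‖ := by
  rw [← norm_smul, smul_sub, yosidaExp, yosidaExp, smul_neg, smul_neg]
  exact ((hM.yosida hε).accretive_smul hz).norm_exp_neg_sub_le
    ((hM.yosida hδ).accretive_smul hz)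
    (((commute_yosida_yosida M ε δ).smul_left z).smul_right z) x

theorem Sectorial.norm_yosidaExp_sub_yosidaExp_le_add (hM : Sectorial c M) (hε : 0 < ε)
    (hδ : 0 < δ) (hz : z ∈ cone c) (x y : X) :
    ‖yosidaExp M ε z x - yosidaExp M δ z x‖
      ≤ 2 * ‖x - y‖ + ‖z‖ * ‖yosida M ε y - yosida M δ y‖ := by
  calc ‖yosidaExp M ε z x - yosidaExp M δ z x‖
      = ‖yosidaExp M ε z (x - y) - yosidaExp M δ z (x - y)
          + (yosidaExp M ε z y - yosidaExp M δ z y)‖ := by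
        rw [map_sub, map_sub]
        congr 1
        abel
    _ ≤ ‖x - y‖ + ‖x - y‖ + ‖z‖ * ‖yosida M ε y - yosida M δ y‖ :=
        (norm_add_le _ _).trans <| add_le_add
          ((norm_sub_le _ _).trans <| add_le_add (hM.norm_yosidaExp_apply_le hε hz _)
            (hM.norm_yosidaExp_apply_le hδ hz _))
          (hM.norm_yosidaExp_sub_yosidaExp_le hε hδ hz _)
    _ = 2 * ‖x - y‖ + ‖z‖ * ‖yosida M ε y - yosida M δ y‖ := by rw [two_mul]

theorem Sectorial.uniformCauchySeqOn_yosidaExp (hM : Sectorial c M) (hd : DenseRange M) (x : X)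
    (R : ℝ) : UniformCauchySeqOn (fun ε z => yosidaExp M ε z x) (𝓝[>] 0)
      (cone c ∩ Metric.closedBall 0 R) := by
  intro u hu
  obtain ⟨η, hη, hηu⟩ := Metric.mem_uniformity_dist.1 hu
  obtain ⟨v, hv⟩ := hd.exists_dist_lt x (by positivity : 0 < η / 4)
  have hcauchy : ∀ᶠ p in 𝓝[>] (0 : ℝ) ×ˢ 𝓝[>] (0 : ℝ),
      R * ‖yosida M p.1 (M v) - yosida M p.2 (M v)‖ < η / 2 := by
    have hlim := hM.accretive.tendsto_yosida_apply hd v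
    have hdiff : Tendsto
        (fun p : ℝ × ℝ => R * ‖yosida M p.1 (M v) - yosida M p.2 (M v)‖)
        (𝓝[>] 0 ×ˢ 𝓝[>] 0) (𝓝 0) := by
      simpa only [sub_self, norm_zero, mul_zero, Function.comp_apply] using
        ((hlim.comp tendsto_fst).sub (hlim.comp tendsto_snd)).norm.const_mul R
    exact hdiff.eventually_lt_const (half_pos hη)
  have hpos : ∀ᶠ p in 𝓝[>] (0 : ℝ) ×ˢ 𝓝[>] (0 : ℝ), 0 < p.1 ∧ 0 < p.2 :=
    prod_mem_prod self_mem_nhdsWithin self_mem_nhdsWithin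
  filter_upwards [hcauchy, hpos] with p hp ⟨hp1, hp2⟩ z ⟨hz, hzR⟩
  refine hηu ?_
  rw [mem_closedBall_zero_iff] at hzR
  rw [dist_eq_norm] at hv ⊢
  calc ‖yosidaExp M p.1 z x - yosidaExp M p.2 z x‖
      ≤ 2 * ‖x - M v‖ + ‖z‖ * ‖yosida M p.1 (M v) - yosida M p.2 (M v)‖ :=
        hM.norm_yosidaExp_sub_yosidaExp_le_add hp1 hp2 hz x (M v)
    _ ≤ 2 * ‖x - M v‖ + R * ‖yosida M p.1 (M v) - yosida M p.2 (M v)‖ := by gcongr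
    _ < η := by linarith

end YosidaExp

section InvSemigroup

open Classical in
/-- The operator `exp (-z M⁻¹)`, as the strong limit of `exp (-z (M + ε)⁻¹)` for `ε ↓ 0`; the value
is `0` if that limit does not exist. -/
noncomputable def invSemigroup (M : X →L[ℂ] X) (z : ℂ) : X →L[ℂ] X :=
  if h : ∃ S : X →L[ℂ] X, ∀ x, Tendsto (fun ε => yosidaExp M ε z x) (𝓝[>] 0) (𝓝 (S x))
  then h.choose else 0

variable [CompleteSpace X] {c : ℝ≥0} {M : X →L[ℂ] X} {z w : ℂ}

theorem Sectorial.tendsto_yosidaExp_apply (hM : Sectorial c M) (hd : DenseRange M)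
    (hz : z ∈ cone c) (x : X) :
    Tendsto (fun ε => yosidaExp M ε z x) (𝓝[>] 0) (𝓝 (invSemigroup M z x)) := by
  have hex : ∃ S : X →L[ℂ] X, ∀ x, Tendsto (fun ε => yosidaExp M ε z x) (𝓝[>] 0) (𝓝 (S x)) := by
    have hlim (x : X) : ∃ y, Tendsto (fun ε => yosidaExp M ε z x) (𝓝[>] 0) (𝓝 y) :=
      CompleteSpace.complete <|
        (hM.uniformCauchySeqOn_yosidaExp hd x ‖z‖).cauchy_map ⟨hz, by simp⟩
    choose S hS using hlim
    exact ⟨continuousLinearMapOfTendsto (fun ε => yosidaExp M ε z) (tendsto_pi_nhds.2 hS), hS⟩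
  rw [invSemigroup, dif_pos hex]
  exact hex.choose_spec x

theorem Sectorial.tendstoLocallyUniformlyOn_yosidaExp (hM : Sectorial c M) (hd : DenseRange M)
    (x : X) : TendstoLocallyUniformlyOn (fun ε z => yosidaExp M ε z x) (fun z => invSemigroup M z x)
      (𝓝[>] 0) (cone c) := by
  refine tendstoLocallyUniformlyOn_of_forall_exists_nhds fun z hz =>
    ⟨cone c ∩ Metric.closedBall 0 (‖z‖ + 1), ?_, ?_⟩
  · exact inter_mem_nhdsWithin _ (Metric.closedBall_mem_nhds_of_mem (by simp))
  · exact (hM.uniformCauchySeqOn_yosidaExp hd x (‖z‖ + 1)).tendstoUniformlyOn_of_tendsto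
      fun w hw => hM.tendsto_yosidaExp_apply hd hw.1 x

theorem Sectorial.invSemigroup_zero (hM : Sectorial c M) (hd : DenseRange M) :
    invSemigroup M 0 = 1 := by
  ext x
  refine tendsto_nhds_unique (hM.tendsto_yosidaExp_apply hd (zero_mem_cone c) x) ?_
  simpa only [yosidaExp_zero] using tendsto_const_nhds

theorem Sectorial.norm_invSemigroup_apply_le (hM : Sectorial c M) (hd : DenseRange M)
    (hz : z ∈ cone c) (x : X) : ‖invSemigroup M z x‖ ≤ ‖x‖ :=
  le_of_tendsto (hM.tendsto_yosidaExp_apply hd hz x).norm <|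
    eventually_mem_nhdsWithin.mono fun _ hε => hM.norm_yosidaExp_apply_le hε hz x

theorem Sectorial.norm_invSemigroup_le (hM : Sectorial c M) (hd : DenseRange M)
    (hz : z ∈ cone c) : ‖invSemigroup M z‖ ≤ 1 :=
  ContinuousLinearMap.opNorm_le_bound _ zero_le_one fun x => by
    simpa only [one_mul] using hM.norm_invSemigroup_apply_le hd hz x

theorem Sectorial.invSemigroup_apply_comm (hM : Sectorial c M) (hd : DenseRange M)
    (hz : z ∈ cone c) (x : X) : invSemigroup M z (M x) = M (invSemigroup M z x) := by
  refine tendsto_nhds_unique (hM.tendsto_yosidaExp_apply hd hz (M x)) ?_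
  simpa only [yosidaExp_apply_comm (commute_yosida M _), Function.comp_def] using
    (M.continuous.tendsto _).comp (hM.tendsto_yosidaExp_apply hd hz x)

/-- Equicontinuity allows passing to the limit in both factors. -/
theorem Sectorial.tendsto_yosidaExp_apply_of_tendsto (hM : Sectorial c M) (hd : DenseRange M)
    (hz : z ∈ cone c) {y : ℝ → X} {x : X} (hy : Tendsto y (𝓝[>] 0) (𝓝 x)) :
    Tendsto (fun ε => yosidaExp M ε z (y ε)) (𝓝[>] 0) (𝓝 (invSemigroup M z x)) := by
  have hsub : Tendsto (fun ε => yosidaExp M ε z (y ε - x)) (𝓝[>] 0) (𝓝 0) :=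
    squeeze_zero_norm' (eventually_mem_nhdsWithin.mono fun ε hε =>
      hM.norm_yosidaExp_apply_le hε hz (y ε - x)) (tendsto_iff_norm_sub_tendsto_zero.1 hy)
  simpa only [map_sub, sub_add_cancel, zero_add] using
    hsub.add (hM.tendsto_yosidaExp_apply hd hz x)

theorem Sectorial.invSemigroup_add (hM : Sectorial c M) (hd : DenseRange M) (hz : z ∈ cone c)
    (hw : w ∈ cone c) : invSemigroup M (z + w) = (invSemigroup M z).comp (invSemigroup M w) := by
  ext x
  refine tendsto_nhds_unique (hM.tendsto_yosidaExp_apply hd (add_mem_cone hz hw) x) ?_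
  simpa only [yosidaExp_add_apply, ContinuousLinearMap.comp_apply] using
    hM.tendsto_yosidaExp_apply_of_tendsto hd hz (hM.tendsto_yosidaExp_apply hd hw x)

theorem Sectorial.continuousOn_invSemigroup_apply (hM : Sectorial c M) (hd : DenseRange M)
    (x : X) : ContinuousOn (fun z => invSemigroup M z x) (cone c) :=
  (hM.tendstoLocallyUniformlyOn_yosidaExp hd x).continuousOn <| Frequently.of_forall fun ε z _ =>
    (hasDerivAt_yosidaExp_apply M ε x z).continuousAt.continuousWithinAt

theorem Sectorial.tendstoLocallyUniformlyOn_yosidaExp_sector (hM : Sectorial c M)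
    (hd : DenseRange M) (x : X) :
    TendstoLocallyUniformlyOn (fun ε z => yosidaExp M ε z x) (fun z => invSemigroup M z x)
      (𝓝[>] 0) (Semigroup.sector (Real.arctan c)) :=
  (hM.tendstoLocallyUniformlyOn_yosidaExp hd x).mono (sector_arctan_subset_cone c)

theorem isOpen_sector_arctan (c : ℝ≥0) : IsOpen (Semigroup.sector (Real.arctan c)) :=
  isOpen_sector ((Real.arctan_lt_pi_div_two c).le.trans (half_le_self Real.pi_pos.le))

theorem Sectorial.differentiableOn_invSemigroup_apply (hM : Sectorial c M) (hd : DenseRange M)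
    (x : X) :
    DifferentiableOn ℂ (fun z => invSemigroup M z x) (Semigroup.sector (Real.arctan c)) :=
  (hM.tendstoLocallyUniformlyOn_yosidaExp_sector hd x).differentiableOn
    (.of_forall fun ε z _ =>
      (hasDerivAt_yosidaExp_apply M ε x z).differentiableAt.differentiableWithinAt)
    (isOpen_sector_arctan c)

theorem Sectorial.hasDerivAt_invSemigroup_apply (hM : Sectorial c M) (hd : DenseRange M) (x : X)
    (hz : z ∈ Semigroup.sector (Real.arctan c)) :
    HasDerivAt (fun z => invSemigroup M z (M x)) (-invSemigroup M z x) z := by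
  have hU := isOpen_sector_arctan c
  have hderiv : Tendsto (fun ε => deriv (fun w => yosidaExp M ε w (M x)) z) (𝓝[>] 0)
      (𝓝 (deriv (fun w => invSemigroup M w (M x)) z)) :=
    ((hM.tendstoLocallyUniformlyOn_yosidaExp_sector hd (M x)).deriv (.of_forall fun ε w _ =>
      (hasDerivAt_yosidaExp_apply M ε (M x) w).differentiableAt.differentiableWithinAt)
      hU).tendsto_at hz
  have hlim : Tendsto (fun ε => deriv (fun w => yosidaExp M ε w (M x)) z) (𝓝[>] 0)
      (𝓝 (-invSemigroup M z x)) := by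
    simp only [(hasDerivAt_yosidaExp_apply M _ (M x) z).deriv]
    exact (hM.tendsto_yosidaExp_apply_of_tendsto hd (sector_arctan_subset_cone c hz)
      (hM.accretive.tendsto_yosida_apply hd x)).neg
  rw [← tendsto_nhds_unique hderiv hlim]
  exact ((hM.differentiableOn_invSemigroup_apply hd (M x)).differentiableAt
    (hU.mem_nhds hz)).hasDerivAt

end InvSemigroup

section NegInv

variable {M : X →L[ℂ] X}

/-- The operator `-M⁻¹`, defined on the range of `M` (for injective `M`). -/
noncomputable def negInv (M : X →L[ℂ] X) : X →ₗ.[ℂ] X :=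
  ((-M).toLinearMap.toPMap ⊤).inverse

theorem mem_graph_negInv_iff (hM : Function.Injective M) {x y : X} :
    (x, y) ∈ (negInv M).graph ↔ x = M (-y) := by
  have hker : ((-M).toLinearMap.toPMap ⊤).toFun.ker = ⊥ := by
    refine LinearMap.ker_eq_bot'.2 fun y hy => Subtype.ext (hM ?_)
    rw [ZeroMemClass.coe_zero, map_zero]
    exact neg_eq_zero.1 hy
  rw [negInv, LinearPMap.inverse_graph hker, Submodule.mem_map]
  simp [LinearPMap.mem_graph_iff, eq_comm]

end NegInv

section Generation

variable [CompleteSpace X] {c : ℝ≥0} {M : X →L[ℂ] X}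

theorem ofReal_mem_sector_arctan (hc : 0 < c) {t : ℝ} (ht : 0 < t) :
    (t : ℂ) ∈ Semigroup.sector (Real.arctan c) := by
  refine ⟨Complex.ofReal_ne_zero.2 ht.ne', ?_⟩
  rw [Complex.arg_ofReal_of_nonneg ht.le, abs_zero]
  exact Real.arctan_pos.2 hc

theorem Sectorial.continuousOn_invSemigroup_ofReal (hM : Sectorial c M) (hd : DenseRange M)
    (x : X) : ContinuousOn (fun t : ℝ => invSemigroup M t x) (Set.Ici 0) :=
  (hM.continuousOn_invSemigroup_apply hd x).comp Complex.continuous_ofReal.continuousOn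
    fun _ ht => ofReal_mem_cone c ht

theorem Sectorial.hasDerivWithinAt_invSemigroup_zero (hM : Sectorial c M) (hd : DenseRange M)
    (hc : 0 < c) (x : X) :
    HasDerivWithinAt (fun t : ℝ => invSemigroup M t (M x)) (-x) (Set.Ici 0) 0 := by
  have hderiv {t : ℝ} (ht : t ∈ Set.Ioi (0 : ℝ)) := hasDerivAt_comp_ofReal
    (hM.hasDerivAt_invSemigroup_apply hd x (ofReal_mem_sector_arctan hc ht))
  have hcont (y : X) : ContinuousWithinAt (fun t : ℝ => invSemigroup M t y) (Set.Ioi 0) 0 :=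
    (hM.continuousOn_invSemigroup_ofReal hd y 0 Set.self_mem_Ici).mono Set.Ioi_subset_Ici_self
  refine hasDerivWithinAt_Ici_of_tendsto_deriv
    (fun t ht => (hderiv ht).differentiableAt.differentiableWithinAt) (hcont (M x))
    self_mem_nhdsWithin ?_
  refine (hcont x).neg.congr' (eventually_mem_nhdsWithin.mono fun t ht => (hderiv ht).deriv.symm)
    |>.trans (le_of_eq ?_)
  simp [hM.invSemigroup_zero hd]

theorem Sectorial.tendsto_invSemigroup_quotient (hM : Sectorial c M) (hd : DenseRange M)
    (hc : 0 < c) (x : X) :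
    Tendsto (fun t : ℝ => (t : ℂ)⁻¹ • (invSemigroup M t (M x) - M x)) (𝓝[>] 0) (𝓝 (-x)) := by
  have hslope := hasDerivWithinAt_iff_tendsto_slope.1
    (hM.hasDerivWithinAt_invSemigroup_zero hd hc x)
  rw [Set.Ici_sdiff_left] at hslope
  refine hslope.congr fun t => ?_
  rw [slope_def_module, sub_zero, Complex.ofReal_zero, hM.invSemigroup_zero hd,
    one_apply_eq_self, ← Complex.ofReal_inv, Complex.coe_smul]

theorem Sectorial.isGenerator_negInv (hM : Sectorial c M) (hd : DenseRange M) (hc : 0 < c) :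
    Semigroup.IsGenerator (negInv M) fun t => invSemigroup M t := by
  intro x y
  rw [mem_graph_negInv_iff (hM.accretive.injective hd)]
  constructor
  · rintro rfl
    simpa only [neg_neg] using hM.tendsto_invSemigroup_quotient hd hc (-y)
  · intro h
    have hMy : Tendsto (fun t : ℝ => (t : ℂ)⁻¹ • (invSemigroup M t (M x) - M x)) (𝓝[>] 0)
        (𝓝 (M y)) := by
      refine ((M.continuous.tendsto y).comp h).congr'
        (eventually_mem_nhdsWithin.mono fun t ht => ?_)
      simp only [Function.comp_apply, map_smul, map_sub,
        hM.invSemigroup_apply_comm hd (ofReal_mem_cone c (le_of_lt ht))]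
    rw [map_neg, ← tendsto_nhds_unique (hM.tendsto_invSemigroup_quotient hd hc x) hMy, neg_neg]

theorem Sectorial.isC0Semigroup_invSemigroup (hM : Sectorial c M) (hd : DenseRange M) :
    Semigroup.IsC0Semigroup fun t => invSemigroup M t where
  map_zero := by
    rw [Complex.ofReal_zero, hM.invSemigroup_zero hd, ContinuousLinearMap.one_def]
  map_add s t hs ht := by
    rw [Complex.ofReal_add,
      hM.invSemigroup_add hd (ofReal_mem_cone c hs) (ofReal_mem_cone c ht)]
  continuousOn := hM.continuousOn_invSemigroup_ofReal hd

theorem Sectorial.hasHolomorphicExtension_invSemigroup (hM : Sectorial c M) (hd : DenseRange M)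
    (hc : 0 < c) : Semigroup.HasHolomorphicExtension fun t => invSemigroup M t :=
  have hbound {z : ℂ} (hz : z ∈ Semigroup.sector (Real.arctan c)) : ‖invSemigroup M z‖ ≤ 1 :=
    hM.norm_invSemigroup_le hd (sector_arctan_subset_cone c hz)
  ⟨Real.arctan c, Real.arctan_pos.2 hc, (Real.arctan_lt_pi_div_two c).le, invSemigroup M,
    differentiableOn_of_forall_apply (isOpen_sector_arctan c) (fun _ => hbound)
      (hM.differentiableOn_invSemigroup_apply hd),
    fun _ _ => rfl, fun _ _ hθ => ⟨1, fun _ hz _ => hbound ⟨hz.1, hz.2.trans hθ⟩⟩⟩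

theorem Sectorial.generatesHolomorphicC0Semigroup_negInv (hM : Sectorial c M)
    (hd : DenseRange M) (hc : 0 < c) :
    Semigroup.GeneratesHolomorphicC0Semigroup (negInv M) :=
  ⟨_, hM.isC0Semigroup_invSemigroup hd, hM.hasHolomorphicExtension_invSemigroup hd hc,
    hM.isGenerator_negInv hd hc⟩

end Generation

section Shift

variable {E : Type*} [NormedAddCommGroup E] [NormedSpace ℂ E] {A : E →ₗ.[ℂ] E} {S : ℝ → E →L[ℂ] E}

theorem mem_graph_vadd_iff (f : E →ₗ[ℂ] E) {x y : E} :
    (x, y) ∈ (f +ᵥ A).graph ↔ (x, y - f x) ∈ A.graph := by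
  simp only [LinearPMap.mem_graph_iff, LinearPMap.vadd_domain, LinearPMap.vadd_apply]
  refine exists_congr fun a => and_congr_right ?_
  rintro rfl
  rw [eq_sub_iff_add_eq']

theorem tendsto_inv_mul_cexp_sub_one (κ : ℂ) :
    Tendsto (fun t : ℝ => (t : ℂ)⁻¹ * (Complex.exp (t * κ) - 1)) (𝓝[>] 0) (𝓝 κ) := by
  have hderiv : HasDerivAt (fun t : ℝ => Complex.exp (t * κ)) κ 0 := by
    simpa using ((hasDerivAt_id (0 : ℂ)).mul_const κ).cexp.comp_ofReal (z := 0)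
  simpa using hderiv.tendsto_slope_zero_right

theorem isC0Semigroup_cexp_smul (hS : Semigroup.IsC0Semigroup S) (κ : ℂ) :
    Semigroup.IsC0Semigroup fun t => Complex.exp (t * κ) • S t where
  map_zero := by
    rw [Complex.ofReal_zero, zero_mul, Complex.exp_zero, one_smul, hS.map_zero]
  map_add s t hs ht := by
    rw [hS.map_add s t hs ht, Complex.ofReal_add, add_mul, Complex.exp_add,
      ContinuousLinearMap.smul_comp, ContinuousLinearMap.comp_smul, smul_smul]
  continuousOn x := by
    have hexp : Continuous fun t : ℝ => Complex.exp (t * κ) := by fun_prop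
    exact hexp.continuousOn.smul (hS.continuousOn x)

theorem hasHolomorphicExtension_cexp_smul (hS : Semigroup.HasHolomorphicExtension S) (κ : ℂ) :
    Semigroup.HasHolomorphicExtension fun t => Complex.exp (t * κ) • S t := by
  obtain ⟨θ, hθ, hθ', T, hT, hTS, hbdd⟩ := hS
  refine ⟨θ, hθ, hθ', fun z => Complex.exp (z * κ) • T z, ?_,
    fun t ht => congrArg (Complex.exp (t * κ) • ·) (hTS t ht), ?_⟩
  · have hexp : Differentiable ℂ fun z : ℂ => Complex.exp (z * κ) := by fun_prop
    exact hexp.differentiableOn.smul hT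
  · intro φ hφ hφθ
    obtain ⟨C, hC⟩ := hbdd φ hφ hφθ
    refine ⟨Real.exp ‖κ‖ * C, fun z hz hz1 => ?_⟩
    have hexp : ‖Complex.exp (z * κ)‖ ≤ Real.exp ‖κ‖ := by
      refine (Complex.norm_exp_le_exp_norm _).trans (Real.exp_le_exp.2 ?_)
      rw [norm_mul]
      exact mul_le_of_le_one_left (norm_nonneg κ) hz1
    rw [norm_smul]
    exact mul_le_mul hexp (hC z hz hz1) (norm_nonneg _) (Real.exp_nonneg _)

theorem isGenerator_cexp_smul (hS : Semigroup.IsC0Semigroup S) (hA : Semigroup.IsGenerator A S)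
    (κ : ℂ) :
    Semigroup.IsGenerator ((κ • LinearMap.id : E →ₗ[ℂ] E) +ᵥ A)
      fun t => Complex.exp (t * κ) • S t := by
  intro x y
  have hSx : Tendsto (fun t => S t x) (𝓝[>] 0) (𝓝 x) := by
    simpa [hS.map_zero] using (hS.continuousOn x 0 Set.self_mem_Ici).mono_left
      (nhdsWithin_mono (0 : ℝ) Set.Ioi_subset_Ici_self)
  have hlim := (tendsto_inv_mul_cexp_sub_one κ).smul hSx
  have hquot (t : ℝ) : (t : ℂ)⁻¹ • ((Complex.exp (t * κ) • S t) x - x) =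
      ((t : ℂ)⁻¹ * (Complex.exp (t * κ) - 1)) • S t x + (t : ℂ)⁻¹ • (S t x - x) := by
    rw [smul_apply]
    module
  simp only [mem_graph_vadd_iff, hA x, hquot, LinearMap.smul_apply, LinearMap.id_apply]
  exact ⟨fun h => by simpa using hlim.add h, fun h => by simpa using h.sub hlim⟩

theorem generatesHolomorphicC0Semigroup_smul_id_vadd
    (hA : Semigroup.GeneratesHolomorphicC0Semigroup A) (κ : ℂ) :
    Semigroup.GeneratesHolomorphicC0Semigroup ((κ • LinearMap.id : E →ₗ[ℂ] E) +ᵥ A) := by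
  obtain ⟨S, hS, hhol, hgen⟩ := hA
  exact ⟨_, isC0Semigroup_cexp_smul hS κ, hasHolomorphicExtension_cexp_smul hhol κ,
    isGenerator_cexp_smul hS hgen κ⟩

end Shift

section FormOperator

theorem inner_self_eq_ofReal_norm_sq {F : Type*} [NormedAddCommGroup F] [InnerProductSpace ℂ F]
    (w : F) : inner ℂ w w = (‖w‖ ^ 2 : ℝ) :=
  (inner_self_eq_norm_sq_to_K w).trans (Complex.ofReal_pow ‖w‖ 2).symm

open scoped InnerProduct

variable {V H : Type*} [NormedAddCommGroup V] [InnerProductSpace ℂ V] [CompleteSpace V]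
  [NormedAddCommGroup H] [InnerProductSpace ℂ H] [CompleteSpace H] {ι B : V →L[ℂ] H}

/-- The bounded operator on `V` that represents the form
`⟪v, x⟫ - ⟪ι v, B x⟫ + ‖B‖ ^ 2 * ⟪ι v, ι x⟫`. -/
noncomputable def shiftedForm (ι B : V →L[ℂ] H) : V →L[ℂ] V :=
  1 + ι† ∘L ((‖B‖ ^ 2 : ℂ) • ι - B)

theorem shiftedForm_apply (ι B : V →L[ℂ] H) (x : V) :
    shiftedForm ι B x = x + (ι†) ((‖B‖ ^ 2 : ℂ) • ι x - B x) := rfl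

theorem norm_sq_le_re_inner_shiftedForm (ι B : V →L[ℂ] H) (x : V) :
    1 / 2 * ‖x‖ ^ 2 ≤ (inner ℂ (shiftedForm ι B x) x).re := by
  have hB : (inner ℂ (B x) (ι x)).re ≤ ‖B‖ * ‖x‖ * ‖ι x‖ :=
    (re_inner_le_norm (𝕜 := ℂ) (B x) (ι x)).trans (by gcongr; exact B.le_opNorm x)
  have hexpand : (inner ℂ (shiftedForm ι B x) x).re =
      ‖x‖ ^ 2 + (‖B‖ ^ 2 * ‖ι x‖ ^ 2 - (inner ℂ (B x) (ι x)).re) := by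
    rw [shiftedForm_apply, inner_add_left, ContinuousLinearMap.adjoint_inner_left, inner_sub_left,
      ← Complex.ofReal_pow, inner_smul_left, Complex.conj_ofReal, Complex.add_re, Complex.sub_re,
      Complex.re_ofReal_mul, inner_self_eq_ofReal_norm_sq, inner_self_eq_ofReal_norm_sq,
      Complex.ofReal_re, Complex.ofReal_re]
  rw [hexpand]
  nlinarith [sq_nonneg (‖x‖ - ‖B‖ * ‖ι x‖), sq_nonneg (‖B‖ * ‖ι x‖)]

theorem isUnit_shiftedForm (ι B : V →L[ℂ] H) : IsUnit (shiftedForm ι B) :=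
  isUnit_of_mul_norm_sq_le_re_inner one_half_pos (norm_sq_le_re_inner_shiftedForm ι B)

/-- The inverse of `‖B‖ ^ 2 - A` for the operator `A = formOperator ι B`. -/
noncomputable def formResolvent (ι B : V →L[ℂ] H) : V →L[ℂ] V :=
  Ring.inverse (shiftedForm ι B) * (ι† ∘L ι)

theorem shiftedForm_formResolvent_apply (ι B : V →L[ℂ] H) (g : V) :
    shiftedForm ι B (formResolvent ι B g) = (ι†) (ι g) :=
  DFunLike.congr_fun (Ring.mul_inverse_cancel_left _ (ι† ∘L ι) (isUnit_shiftedForm ι B)) g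

theorem eq_formResolvent_apply_iff {x g : V} :
    x = formResolvent ι B g ↔ x = (ι†) (ι g - (‖B‖ ^ 2 : ℂ) • ι x + B x) := by
  have hinj : Function.Injective (shiftedForm ι B) :=
    (ContinuousLinearMap.isUnit_iff_bijective.1 (isUnit_shiftedForm ι B)).1
  rw [← hinj.eq_iff, shiftedForm_formResolvent_apply, shiftedForm_apply, ← eq_sub_iff_add_eq,
    ← map_sub, ← sub_add, sub_add_eq_add_sub, add_sub_right_comm]

theorem sectorial_formResolvent (ι B : V →L[ℂ] H) : Sectorial 1 (formResolvent ι B) := by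
  intro g
  set x := formResolvent ι B g
  set w := ι g - (‖B‖ ^ 2 : ℂ) • ι x + B x with hw
  have hx : x = (ι†) w := eq_formResolvent_apply_iff.1 rfl
  have hwx : inner ℂ w (ι x) = (‖x‖ ^ 2 : ℝ) := by
    rw [← ContinuousLinearMap.adjoint_inner_left, ← hx, inner_self_eq_ofReal_norm_sq]
  have hg : ι g = w + (‖B‖ ^ 2 : ℂ) • ι x - B x := by rw [hw]; abel
  have hinner : inner ℂ x g = (‖w‖ ^ 2 + ‖B‖ ^ 2 * ‖x‖ ^ 2 : ℝ) - inner ℂ w (B x) := by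
    nth_rewrite 1 [hx]
    rw [ContinuousLinearMap.adjoint_inner_left, hg, inner_sub_right, inner_add_right,
      inner_smul_right, hwx, inner_self_eq_ofReal_norm_sq]
    push_cast
    ring
  have hB : ‖inner ℂ w (B x)‖ ≤ ‖w‖ * (‖B‖ * ‖x‖) :=
    (norm_inner_le_norm _ _).trans (by gcongr; exact B.le_opNorm x)
  have him := (Complex.abs_im_le_norm _).trans hB
  have hre := (Complex.re_le_norm _).trans hB
  rw [hinner, Complex.sub_re, Complex.sub_im, Complex.ofReal_re, Complex.ofReal_im, zero_sub,
    abs_neg, NNReal.coe_one, one_mul]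
  nlinarith [sq_nonneg (‖w‖ - ‖B‖ * ‖x‖)]

theorem denseRange_adjoint_comp_self (hι : Function.Injective ι) : DenseRange (ι† ∘L ι) := by
  have hrange : (ι† ∘L ι).rangeᗮ = ⊥ := by
    rw [ContinuousLinearMap.orthogonal_range, ContinuousLinearMap.adjoint_comp,
      ContinuousLinearMap.adjoint_adjoint, ContinuousLinearMap.ker_adjoint_comp_self]
    exact LinearMap.ker_eq_bot.2 hι
  exact Submodule.dense_iff_topologicalClosure_eq_top.2
    (Submodule.topologicalClosure_eq_top_iff.2 hrange)

theorem denseRange_formResolvent (hι : Function.Injective ι) (B : V →L[ℂ] H) :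
    DenseRange (formResolvent ι B) := by
  have hbij : Function.Bijective ⇑(Ring.inverse (shiftedForm ι B)) :=
    ContinuousLinearMap.isUnit_iff_bijective.1 (isUnit_shiftedForm ι B).ringInverse
  exact hbij.2.denseRange.comp (denseRange_adjoint_comp_self hι)
    (Ring.inverse (shiftedForm ι B)).continuous

/-- For an embedding `ι : V → H`, the operator `A` in `V` given by
`⟪ι v, ι (A x)⟫ = -(⟪v, x⟫ - ⟪ι v, B x⟫)` for all `v`, that is, the negative of the part in `V` of
the operator in `H` associated with this form. -/
noncomputable def formOperator (ι B : V →L[ℂ] H) : V →ₗ.[ℂ] V :=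
  ((‖B‖ ^ 2 : ℂ) • LinearMap.id : V →ₗ[ℂ] V) +ᵥ negInv (formResolvent ι B)

theorem generatesHolomorphicC0Semigroup_formOperator (hι : Function.Injective ι)
    (B : V →L[ℂ] H) : Semigroup.GeneratesHolomorphicC0Semigroup (formOperator ι B) :=
  generatesHolomorphicC0Semigroup_smul_id_vadd ((sectorial_formResolvent ι B)
    |>.generatesHolomorphicC0Semigroup_negInv (denseRange_formResolvent hι B) one_pos) _

theorem mem_graph_formOperator_iff (hι : Function.Injective ι) {x y : V} :
    (x, y) ∈ (formOperator ι B).graph ↔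
      ∀ v, inner ℂ v x = inner ℂ (ι v) (B x - ι y) := by
  have hinj := (sectorial_formResolvent ι B).accretive.injective (denseRange_formResolvent hι B)
  rw [formOperator, mem_graph_vadd_iff, mem_graph_negInv_iff hinj, neg_sub,
    eq_formResolvent_apply_iff, LinearMap.smul_apply, LinearMap.id_apply, map_sub, map_smul,
    sub_right_comm, sub_self, zero_sub, neg_add_eq_sub, ext_iff_inner_left ℂ]
  simp only [ContinuousLinearMap.adjoint_inner_right]

end FormOperator

end HolomorphicSemigroup

namespace Wentzell

noncomputable section

variable {d : ℕ} {Ω : Set (EuclideanSpace ℝ (Fin d))}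

section IntegralInner

variable {α : Type*} [MeasurableSpace α] {μ : Measure α}

theorem integral_mul_conj_eq_inner (f w : Lp ℂ 2 μ) {v : α → ℂ} (h : w =ᵐ[μ] v) :
    ∫ x, f x * starRingEnd ℂ (v x) ∂μ = inner ℂ w f := by
  rw [L2.inner_def]
  refine integral_congr_ae ?_
  filter_upwards [h] with x hx
  rw [hx, RCLike.inner_apply]

theorem integral_mul_eq_inner (f w : Lp ℂ 2 μ) {η : α → ℂ}
    (h : w =ᵐ[μ] fun x => starRingEnd ℂ (η x)) : ∫ x, f x * η x ∂μ = inner ℂ w f := by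
  simp only [← integral_mul_conj_eq_inner f w h, Complex.conj_conj]

theorem continuous_integral_mul {η : α → ℂ} (hη : MemLp η 2 μ) :
    Continuous (fun f : Lp ℂ 2 μ => ∫ x, f x * η x ∂μ) := by
  simp only [fun f => integral_mul_eq_inner f _ hη.star.coeFn_toLp]
  fun_prop

variable {ι : Type*} [Fintype ι]

theorem continuous_integral_coord_mul (i : ι) {η : α → ℂ} (hη : MemLp η 2 μ) :
    Continuous (fun g : Lp (EuclideanSpace ℂ ι) 2 μ => ∫ x, g x i * η x ∂μ) := by
  let coord : EuclideanSpace ℂ ι →L[ℂ] ℂ := EuclideanSpace.proj i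
  have h (g : Lp (EuclideanSpace ℂ ι) 2 μ) :
      ∫ x, g x i * η x ∂μ = ∫ x, coord.compLpL 2 μ g x * η x ∂μ := by
    refine integral_congr_ae ?_
    filter_upwards [coord.coeFn_compLpL g] with x hx
    rw [hx]
    rfl
  simp only [h]
  exact (continuous_integral_mul hη).comp (coord.compLpL 2 μ).continuous

theorem integral_sum_mul_conj_eq_inner (f g : Lp (EuclideanSpace ℂ ι) 2 μ) :
    ∫ x, ∑ i, f x i * starRingEnd ℂ (g x i) ∂μ = inner ℂ g f := by
  simp only [L2.inner_def, PiLp.inner_apply, RCLike.inner_apply]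

end IntegralInner

section TestFunction

variable {η ζ : EuclideanSpace ℝ (Fin d) → ℂ}

protected theorem IsTestFunction.star (hη : IsTestFunction Ω η) :
    IsTestFunction Ω (fun x => starRingEnd ℂ (η x)) where
  contDiff := Complex.conjCLE.contDiff.comp hη.contDiff
  hasCompactSupport := hη.hasCompactSupport.comp_left (map_zero _)
  tsupport_subset := (closure_mono (Function.support_comp_subset (map_zero _) η)).trans
    hη.tsupport_subset

theorem partialDeriv_star (i : Fin d) (η : EuclideanSpace ℝ (Fin d) → ℂ)
    (x : EuclideanSpace ℝ (Fin d)) :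
    partialDeriv i (fun x => starRingEnd ℂ (η x)) x = starRingEnd ℂ (partialDeriv i η x) :=
  congrArg (fun L : EuclideanSpace ℝ (Fin d) →L[ℝ] ℂ => L (EuclideanSpace.single i 1))
    (Complex.conjCLE.comp_fderiv (f := η) (x := x))

protected theorem IsTestFunction.partialDeriv (hη : IsTestFunction Ω η) (i : Fin d) :
    IsTestFunction Ω (partialDeriv i η) where
  contDiff := (hη.contDiff.fderiv_right (m := ∞) (by simp)).clm_apply contDiff_const
  hasCompactSupport := hη.hasCompactSupport.fderiv_apply ℝ _
  tsupport_subset := (tsupport_fderiv_apply_subset ℝ _).trans hη.tsupport_subset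

theorem IsTestFunction.eq_zero (hη : IsTestFunction Ω η) {x : EuclideanSpace ℝ (Fin d)}
    (hx : x ∉ Ω) : η x = 0 :=
  image_eq_zero_of_notMem_tsupport fun h => hx (hη.tsupport_subset h)

theorem IsTestFunction.integrable_mul (hη : IsTestFunction Ω η) (hζ : IsTestFunction Ω ζ) :
    Integrable (fun x => η x * ζ x) :=
  (hη.contDiff.continuous.mul hζ.contDiff.continuous).integrable_of_hasCompactSupport
    hη.hasCompactSupport.mul_right

theorem laplacian_eq_sum (hη : ContDiff ℝ 2 η) (x : EuclideanSpace ℝ (Fin d)) :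
    Laplacian.laplacian η x = ∑ i, partialDeriv i (partialDeriv i η) x := by
  rw [InnerProductSpace.laplacian_eq_iteratedFDeriv_orthonormalBasis η
    (EuclideanSpace.basisFun (Fin d) ℝ)]
  refine Finset.sum_congr rfl fun i _ => ?_
  have hd : DifferentiableAt ℝ (fderiv ℝ η) x :=
    (hη.fderiv_right (m := 1) one_add_one_eq_two.le).differentiable one_ne_zero x
  have h := hd.hasFDerivAt.clm_apply (hasFDerivAt_const (EuclideanSpace.single i (1 : ℝ)) x)
  unfold partialDeriv
  rw [iteratedFDeriv_two_apply, h.fderiv]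
  simp

theorem ae_eq_zero_of_forall_testFunction (hΩ : IsOpen Ω) {f : EuclideanSpace ℝ (Fin d) → ℂ}
    (hf : LocallyIntegrableOn f Ω)
    (h : ∀ η, IsTestFunction Ω η → ∫ x in Ω, f x * η x = 0) : f =ᵐ[volume.restrict Ω] 0 := by
  refine (ae_restrict_iff' hΩ.measurableSet).2
    (hΩ.ae_eq_zero_of_integral_contDiff_smul_eq_zero hf fun g hg hgc hgs => ?_)
  have hη : IsTestFunction Ω (fun x => (g x : ℂ)) :=
    ⟨Complex.ofRealCLM.contDiff.comp hg, hgc.comp_left Complex.ofReal_zero,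
      (closure_mono (Function.support_comp_subset Complex.ofReal_zero g)).trans hgs⟩
  calc ∫ x, g x • f x = ∫ x, f x * g x := by simp only [Complex.real_smul, mul_comm]
    _ = ∫ x in Ω, f x * g x := (setIntegral_eq_integral_of_forall_compl_eq_zero fun x hx => by
        rw [hη.eq_zero hx, mul_zero]).symm
    _ = 0 := h _ hη

theorem ae_eq_of_forall_testFunction (hΩ : IsOpen Ω) {f g : EuclideanSpace ℝ (Fin d) → ℂ}
    (hf : MemLp f 2 (volume.restrict Ω)) (hg : MemLp g 2 (volume.restrict Ω))
    (h : ∀ η, IsTestFunction Ω η → ∫ x in Ω, f x * η x = ∫ x in Ω, g x * η x) :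
    f =ᵐ[volume.restrict Ω] g := by
  have hloc : LocallyIntegrableOn (f - g) Ω :=
    locallyIntegrableOn_of_locallyIntegrable_restrict
      ((hf.sub hg).locallyIntegrable one_le_two)
  refine (sub_ae_eq_zero f g).1 (ae_eq_zero_of_forall_testFunction hΩ hloc fun η hη => ?_)
  simp only [Pi.sub_apply, sub_mul]
  exact (integral_sub (hf.integrable_mul hη.memLp) (hg.integrable_mul hη.memLp)).trans
    (sub_eq_zero.2 (h η hη))

end TestFunction

section WeakDerivative

theorem IsWeakGradient.unique (hΩ : IsOpen Ω) {u : L2Dom Ω} {g g' : L2Vec Ω}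
    (h : IsWeakGradient u g) (h' : IsWeakGradient u g') : g = g' := by
  have hcoord (i : Fin d) : (fun x => g x i) =ᵐ[volume.restrict Ω] fun x => g' x i :=
    ae_eq_of_forall_testFunction hΩ (memLp_coord g i) (memLp_coord g' i) fun η hη =>
      neg_injective ((h η hη i).symm.trans (h' η hη i))
  refine Lp.ext ?_
  filter_upwards [ae_all_iff.2 hcoord] with x hx
  exact PiLp.ext hx

theorem HasWeakLaplacian.unique (hΩ : IsOpen Ω) {u f f' : L2Dom Ω}
    (h : HasWeakLaplacian u f) (h' : HasWeakLaplacian u f') : f = f' :=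
  Lp.ext (ae_eq_of_forall_testFunction hΩ (Lp.memLp f) (Lp.memLp f') fun η hη =>
    (h η hη).symm.trans (h' η hη))

theorem H1.fn_injective (hΩ : IsOpen Ω) : Function.Injective (H1.fn : H1 Ω → L2Dom Ω) := by
  intro u v h
  have hgrad : u.grad = v.grad := IsWeakGradient.unique hΩ (u := u.fn) u.2 (h ▸ v.2)
  exact Subtype.ext (WithLp.ofLp_injective 2 (Prod.ext h hgrad))

theorem H1.integral_mul_laplacian (u : H1 Ω) {η : EuclideanSpace ℝ (Fin d) → ℂ}
    (hη : IsTestFunction Ω η) : ∫ x in Ω, u.fn x * Laplacian.laplacian η x =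
      -∫ x in Ω, ∑ i, u.grad x i * partialDeriv i η x := by
  have hfn (i : Fin d) : Integrable (fun x => u.fn x * partialDeriv i (partialDeriv i η) x)
      (volume.restrict Ω) :=
    (Lp.memLp u.fn).integrable_mul ((hη.partialDeriv i).memLp_partialDeriv i)
  have hgrad (i : Fin d) : Integrable (fun x => u.grad x i * partialDeriv i η x)
      (volume.restrict Ω) :=
    (memLp_coord u.grad i).integrable_mul (hη.memLp_partialDeriv i)
  simp only [laplacian_eq_sum (hη.contDiff.of_le (WithTop.coe_le_coe.2 le_top)), Finset.mul_sum]
  rw [integral_finsetSum _ fun i _ => hfn i, integral_finsetSum _ fun i _ => hgrad i,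
    ← Finset.sum_neg_distrib]
  exact Finset.sum_congr rfl fun i _ => u.2 _ (hη.partialDeriv i) i

end WeakDerivative

namespace IsTestFunction

variable {η ζ : EuclideanSpace ℝ (Fin d) → ℂ}

theorem memLp_grad (hη : IsTestFunction Ω η) :
    MemLp (fun x => WithLp.toLp 2 fun i => partialDeriv i η x) 2 (volume.restrict Ω) :=
  memLp_piLp_iff.2 hη.memLp_partialDeriv

theorem coeFn_toLp_grad (hη : IsTestFunction Ω η) (i : Fin d) :
    (fun x => hη.memLp_grad.toLp _ x i) =ᵐ[volume.restrict Ω] partialDeriv i η := by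
  filter_upwards [hη.memLp_grad.coeFn_toLp] with x hx
  rw [hx]

theorem setIntegral_mul_partialDeriv (hη : IsTestFunction Ω η) (hζ : IsTestFunction Ω ζ)
    (i : Fin d) :
    ∫ x in Ω, η x * partialDeriv i ζ x = -∫ x in Ω, partialDeriv i η x * ζ x := by
  rw [setIntegral_eq_integral_of_forall_compl_eq_zero fun x hx => by
      rw [hη.eq_zero hx, zero_mul],
    setIntegral_eq_integral_of_forall_compl_eq_zero fun x hx => by
      rw [hζ.eq_zero hx, mul_zero]]
  exact integral_mul_fderiv_eq_neg_fderiv_mul_of_integrable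
    ((hη.partialDeriv i).integrable_mul hζ) (hη.integrable_mul (hζ.partialDeriv i))
    (hη.integrable_mul hζ) (fun x _ => hη.contDiff.differentiable (by simp) x)
    (fun x _ => hζ.contDiff.differentiable (by simp) x)

theorem isWeakGradient (hη : IsTestFunction Ω η) :
    IsWeakGradient (hη.memLp.toLp η) (hη.memLp_grad.toLp _) := by
  intro ζ hζ i
  calc ∫ x in Ω, hη.memLp.toLp η x * partialDeriv i ζ x
    _ = ∫ x in Ω, η x * partialDeriv i ζ x :=
      integral_congr_ae (hη.memLp.coeFn_toLp.mul (ae_eq_refl (partialDeriv i ζ)))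
    _ = -∫ x in Ω, partialDeriv i η x * ζ x := hη.setIntegral_mul_partialDeriv hζ i
    _ = -∫ x in Ω, hη.memLp_grad.toLp _ x i * ζ x :=
      congrArg Neg.neg (integral_congr_ae ((hη.coeFn_toLp_grad i).mul (ae_eq_refl ζ))).symm

/-- A test function as an element of `H¹(Ω)`. -/
def toH1 (hη : IsTestFunction Ω η) : H1 Ω :=
  ⟨WithLp.toLp 2 (hη.memLp.toLp η, hη.memLp_grad.toLp _), hη.isWeakGradient⟩

theorem integral_mul_eq_inner_toH1_star (hη : IsTestFunction Ω η) (f : L2Dom Ω) :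
    ∫ x in Ω, f x * η x = inner ℂ hη.star.toH1.fn f :=
  integral_mul_eq_inner f _ hη.star.memLp.coeFn_toLp

theorem integral_sum_mul_partialDeriv_eq_inner_toH1_star (hη : IsTestFunction Ω η)
    (g : L2Vec Ω) :
    ∫ x in Ω, ∑ i, g x i * partialDeriv i η x = inner ℂ hη.star.toH1.grad g := by
  rw [← integral_sum_mul_conj_eq_inner]
  refine integral_congr_ae ?_
  filter_upwards [ae_all_iff.2 hη.star.coeFn_toLp_grad] with x hx
  refine Finset.sum_congr rfl fun i _ => ?_
  rw [← Complex.conj_conj (partialDeriv i η x), ← partialDeriv_star, ← hx i]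
  rfl

end IsTestFunction

section HilbertSpace

instance : InnerProductSpace ℂ (H1 Ω) := Submodule.innerProductSpace (H1Submodule Ω)

theorem isClosed_H1Submodule :
    IsClosed (H1Submodule Ω : Set (WithLp 2 (L2Dom Ω × L2Vec Ω))) := by
  have h : (H1Submodule Ω : Set (WithLp 2 (L2Dom Ω × L2Vec Ω))) =
      ⋂ (η : EuclideanSpace ℝ (Fin d) → ℂ) (_ : IsTestFunction Ω η) (i : Fin d),
        {p | ∫ x in Ω, p.fst x * partialDeriv i η x = -∫ x in Ω, p.snd x i * η x} := by
    ext p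
    simp only [Set.mem_iInter]
    rfl
  rw [h]
  refine isClosed_iInter fun η => isClosed_iInter fun hη => isClosed_iInter fun i => ?_
  exact isClosed_eq
    ((continuous_integral_mul (hη.memLp_partialDeriv i)).comp (WithLp.continuous_fst ..))
    ((continuous_integral_coord_mul i hη.memLp).comp (WithLp.continuous_snd ..)).neg

instance : CompleteSpace (H1 Ω) := isClosed_H1Submodule.completeSpace_coe

/-- The pairs `(v, v|_Γ)` with `v ∈ C(closure Ω) ∩ H¹(Ω)`, as elements of `H¹(Ω) ⊕ L²(Γ)`. -/
def contPairs (Ω : Set (EuclideanSpace ℝ (Fin d))) : Set (WithLp 2 (H1 Ω × L2Bdry Ω)) :=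
  {p | ∃ v, IsContH1 v p.fst ∧ p.snd =ᵐ[bdryMeasure Ω] v}

theorem coe_VSubmodule : (VSubmodule Ω : Set (WithLp 2 (H1 Ω × L2Bdry Ω))) =
    closure (contPairs Ω) := by
  ext p
  rw [mem_closure_iff_seq_limit]
  constructor
  · rintro ⟨v, w, ψ, hvw, hψv, hw, hψ⟩
    exact ⟨fun n => WithLp.toLp 2 (w n, ψ n), fun n => ⟨v n, hvw n, hψv n⟩,
      ((WithLp.prod_continuous_toLp ..).tendsto _).comp (hw.prodMk_nhds hψ)⟩
  · rintro ⟨q, hq, hlim⟩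
    choose v hvw hψv using hq
    exact ⟨v, fun n => (q n).fst, fun n => (q n).snd, hvw, hψv,
      ((WithLp.continuous_fst ..).tendsto _).comp hlim,
      ((WithLp.continuous_snd ..).tendsto _).comp hlim⟩

instance : InnerProductSpace ℂ (V Ω) := Submodule.innerProductSpace (VSubmodule Ω)

instance : CompleteSpace (V Ω) :=
  (coe_VSubmodule (Ω := Ω) ▸ isClosed_closure :
    IsClosed (VSubmodule Ω : Set (WithLp 2 (H1 Ω × L2Bdry Ω)))).completeSpace_coe

theorem V.inner_eq (x y : V Ω) : inner ℂ x y = inner ℂ x.fn.fn y.fn.fn +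
    inner ℂ x.fn.grad y.fn.grad + inner ℂ x.bdry y.bdry := rfl

end HilbertSpace

section GreenIdentity

/-- Green's formula `∫_Ω (f v̄ + ∇u · ∇v̄) = ∫_Γ h ψ̄` tested with a pair `p = (v, ψ)`, where `f`
and `h` stand for `Δu` and `∂_ν u`. It is stated with inner products so as to be closed in `p`. -/
def GreenIdentity (u : H1 Ω) (f : L2Dom Ω) (h : L2Bdry Ω) (p : WithLp 2 (H1 Ω × L2Bdry Ω)) :
    Prop :=
  inner ℂ p.fst.fn f + inner ℂ p.fst.grad u.grad = inner ℂ p.snd h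

variable {u : H1 Ω} {f : L2Dom Ω} {h : L2Bdry Ω}

theorem IsContH1.greenIdentity_iff {v : EuclideanSpace ℝ (Fin d) → ℂ} {w : H1 Ω}
    {ψ : L2Bdry Ω} (hvw : IsContH1 v w) (hψ : ψ =ᵐ[bdryMeasure Ω] v) :
    GreenIdentity u f h (WithLp.toLp 2 (w, ψ)) ↔
      (∫ x in Ω, f x * starRingEnd ℂ (v x)) +
        (∫ x in Ω, ∑ i : Fin d, u.grad x i * starRingEnd ℂ (w.grad x i)) =
      ∫ z, h z * starRingEnd ℂ (v z) ∂(bdryMeasure Ω) := by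
  rw [integral_mul_conj_eq_inner _ _ hvw.ae_eq, integral_mul_conj_eq_inner _ _ hψ,
    integral_sum_mul_conj_eq_inner]
  rfl

theorem isClosed_setOf_greenIdentity (u : H1 Ω) (f : L2Dom Ω) (h : L2Bdry Ω) :
    IsClosed {p | GreenIdentity u f h p} := by
  let toH1 := WithLp.fstL 2 ℂ (H1 Ω) (L2Bdry Ω)
  have hfn : Continuous fun p : WithLp 2 (H1 Ω × L2Bdry Ω) => p.fst.fn :=
    (WithLp.continuous_fst ..).comp (continuous_subtype_val.comp toH1.continuous)
  have hgrad : Continuous fun p : WithLp 2 (H1 Ω × L2Bdry Ω) => p.fst.grad :=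
    (WithLp.continuous_snd ..).comp (continuous_subtype_val.comp toH1.continuous)
  exact isClosed_eq ((hfn.inner continuous_const).add (hgrad.inner continuous_const))
    ((WithLp.continuous_snd ..).inner continuous_const)

theorem forall_V_greenIdentity_iff :
    (∀ x : V Ω, GreenIdentity u f h x.1) ↔ ∀ p ∈ contPairs Ω, GreenIdentity u f h p := by
  have hV (p : WithLp 2 (H1 Ω × L2Bdry Ω)) : p ∈ VSubmodule Ω ↔ p ∈ closure (contPairs Ω) := by
    rw [← coe_VSubmodule, SetLike.mem_coe]
  exact ⟨fun hall p hp => hall ⟨p, (hV p).2 (subset_closure hp)⟩, fun hall x =>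
    closure_minimal hall (isClosed_setOf_greenIdentity u f h) ((hV x.1).1 x.2)⟩

theorem IsTestFunction.toH1_zero_mem_contPairs (hΩ : IsOpen Ω)
    {η : EuclideanSpace ℝ (Fin d) → ℂ} (hη : IsTestFunction Ω η) :
    WithLp.toLp 2 (hη.toH1, 0) ∈ contPairs Ω := by
  refine ⟨η, ⟨hη.contDiff.continuous.continuousOn, hη.memLp.coeFn_toLp⟩, ?_⟩
  filter_upwards [Lp.coeFn_zero ℂ 2 (bdryMeasure Ω),
    ae_restrict_mem isClosed_frontier.measurableSet] with z hz hzΓ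
  rw [WithLp.toLp_snd, hz, Pi.zero_apply,
    hη.eq_zero ((disjoint_frontier_iff_isOpen.2 hΩ).notMem_of_mem_left hzΓ)]

theorem hasWeakLaplacian_of_greenIdentity (hΩ : IsOpen Ω)
    (hgreen : ∀ p ∈ contPairs Ω, GreenIdentity u f h p) : HasWeakLaplacian u.fn f := by
  intro η hη
  have hη_green := hgreen _ (hη.star.toH1_zero_mem_contPairs hΩ)
  rw [GreenIdentity, WithLp.toLp_fst, WithLp.toLp_snd, inner_zero_left] at hη_green
  rw [u.integral_mul_laplacian hη, hη.integral_mul_eq_inner_toH1_star,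
    hη.integral_sum_mul_partialDeriv_eq_inner_toH1_star]
  exact (eq_neg_of_add_eq_zero_left hη_green).symm

theorem exists_bdry_of_continuousOn [IsFiniteMeasure (bdryMeasure Ω)]
    (hΩ : Bornology.IsBounded Ω) {v : EuclideanSpace ℝ (Fin d) → ℂ}
    (hv : ContinuousOn v (closure Ω)) : ∃ ψ : L2Bdry Ω, ψ =ᵐ[bdryMeasure Ω] v := by
  have hΓ : IsCompact (frontier Ω) :=
    hΩ.isCompact_closure.of_isClosed_subset isClosed_frontier frontier_subset_closure
  have hvΓ := hv.mono frontier_subset_closure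
  obtain ⟨C, hC⟩ := hΓ.exists_bound_of_continuousOn hvΓ
  have hm : MemLp v 2 (bdryMeasure Ω) :=
    MemLp.of_bound (hvΓ.aestronglyMeasurable hΓ.measurableSet) C
      (ae_restrict_of_forall_mem hΓ.measurableSet hC)
  exact ⟨hm.toLp v, hm.coeFn_toLp⟩

theorem hasWeakLaplacian_and_hasNormalDeriv_iff [IsFiniteMeasure (bdryMeasure Ω)]
    (hΩ_open : IsOpen Ω) (hΩ_bdd : Bornology.IsBounded Ω) :
    HasWeakLaplacian u.fn f ∧ HasNormalDeriv u h ↔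
      ∀ p ∈ contPairs Ω, GreenIdentity u f h p := by
  constructor
  · rintro ⟨hlap, f', hf', hgreen⟩ p ⟨v, hvw, hψ⟩
    obtain rfl := hlap.unique hΩ_open hf'
    exact (hvw.greenIdentity_iff hψ).2 (hgreen v p.fst hvw)
  · intro hgreen
    have hlap := hasWeakLaplacian_of_greenIdentity hΩ_open hgreen
    refine ⟨hlap, f, hlap, fun v w hvw => ?_⟩
    obtain ⟨ψ, hψ⟩ := exists_bdry_of_continuousOn hΩ_bdd hvw.continuousOn
    exact (hvw.greenIdentity_iff hψ).1 (hgreen _ ⟨v, hvw, hψ⟩)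

end GreenIdentity

section WentzellOperator

/-- The map `(u, φ) ↦ u` from `V` to `L²(Ω)`. -/
def V.fnL (Ω : Set (EuclideanSpace ℝ (Fin d))) : V Ω →L[ℂ] L2Dom Ω :=
  WithLp.fstL 2 ℂ (L2Dom Ω) (L2Vec Ω) ∘L (H1Submodule Ω).subtypeL ∘L
    WithLp.fstL 2 ℂ (H1 Ω) (L2Bdry Ω) ∘L (VSubmodule Ω).subtypeL

/-- The map `(u, φ) ↦ φ` from `V` to `L²(Γ)`. -/
def V.bdryL (Ω : Set (EuclideanSpace ℝ (Fin d))) : V Ω →L[ℂ] L2Bdry Ω :=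
  WithLp.sndL 2 ℂ (H1 Ω) (L2Bdry Ω) ∘L (VSubmodule Ω).subtypeL

/-- `V.toL2Sum` as a continuous linear map. -/
def embedding (Ω : Set (EuclideanSpace ℝ (Fin d))) : V Ω →L[ℂ] L2Sum Ω :=
  (WithLp.prodContinuousLinearEquiv 2 ℂ (L2Dom Ω) (L2Bdry Ω)).symm.toContinuousLinearMap ∘L
    (V.fnL Ω).prod (V.bdryL Ω)

theorem embedding_apply (x : V Ω) : embedding Ω x = x.toL2Sum := rfl

theorem embedding_injective (hΩ : IsOpen Ω) : Function.Injective (embedding Ω) := by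
  intro x y h
  rw [embedding_apply, embedding_apply] at h
  obtain ⟨hfn, hbdry⟩ := Prod.mk.inj (WithLp.toLp_injective 2 h)
  exact Subtype.ext (WithLp.ofLp_injective 2 (Prod.ext (H1.fn_injective hΩ hfn) hbdry))

/-- The map `(u, φ) ↦ (u, φ - β φ)`, by which the inner product of `V` exceeds the form
`∫_Ω ∇u · ∇v̄ + ∫_Γ β φ ψ̄` of the Wentzell Laplacian. -/
def perturbedEmbedding (β : LinftyBdry Ω) : V Ω →L[ℂ] L2Sum Ω :=
  (WithLp.prodContinuousLinearEquiv 2 ℂ (L2Dom Ω) (L2Bdry Ω)).symm.toContinuousLinearMap ∘L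
    (V.fnL Ω).prod (V.bdryL Ω -
      (ContinuousLinearMap.lsmul ℂ ℂ).holderL (bdryMeasure Ω) ⊤ 2 2 β ∘L V.bdryL Ω)

theorem perturbedEmbedding_apply (β : LinftyBdry Ω) (x : V Ω) : perturbedEmbedding β x =
    WithLp.toLp 2 (x.fn.fn, x.bdry - (β • x.bdry : L2Bdry Ω)) := rfl

theorem inner_embedding_perturbedEmbedding_sub (β : LinftyBdry Ω) (x y v : V Ω) :
    inner ℂ (embedding Ω v) (perturbedEmbedding β x - embedding Ω y) =
      inner ℂ v.fn.fn (x.fn.fn - y.fn.fn) +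
        inner ℂ v.bdry (x.bdry - (β • x.bdry : L2Bdry Ω) - y.bdry) := by
  rw [embedding_apply, embedding_apply, perturbedEmbedding_apply, V.toL2Sum, V.toL2Sum,
    ← WithLp.toLp_sub, Prod.mk_sub_mk, WithLp.prod_inner_apply]

theorem inner_eq_inner_embedding_iff_greenIdentity (β : LinftyBdry Ω) (x y v : V Ω) :
    inner ℂ v x = inner ℂ (embedding Ω v) (perturbedEmbedding β x - embedding Ω y) ↔
      GreenIdentity x.fn y.fn.fn (-y.bdry - (β • x.bdry : L2Bdry Ω)) v.1 := by
  have hgreen : GreenIdentity x.fn y.fn.fn (-y.bdry - (β • x.bdry : L2Bdry Ω)) v.1 ↔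
      inner ℂ v.fn.fn y.fn.fn + inner ℂ v.fn.grad x.fn.grad =
        inner ℂ v.bdry (-y.bdry - (β • x.bdry : L2Bdry Ω)) := Iff.rfl
  rw [hgreen, inner_embedding_perturbedEmbedding_sub, V.inner_eq]
  simp only [inner_sub_right, inner_neg_right]
  constructor <;> intro h <;> linear_combination h

/-- The part of the Wentzell Laplacian in `V`, given by its weak formulation. -/
def wentzellOperator (Ω : Set (EuclideanSpace ℝ (Fin d))) (β : LinftyBdry Ω) :
    V Ω →ₗ.[ℂ] V Ω :=
  HolomorphicSemigroup.formOperator (embedding Ω) (perturbedEmbedding β)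

theorem generatesHolomorphicC0Semigroup_wentzellOperator (hΩ : IsOpen Ω) (β : LinftyBdry Ω) :
    Semigroup.GeneratesHolomorphicC0Semigroup (wentzellOperator Ω β) :=
  HolomorphicSemigroup.generatesHolomorphicC0Semigroup_formOperator (ι := embedding Ω)
    (embedding_injective hΩ) (perturbedEmbedding β)

theorem mem_graph_wentzellOperator_iff [IsFiniteMeasure (bdryMeasure Ω)] (hΩ_open : IsOpen Ω)
    (hΩ_bdd : Bornology.IsBounded Ω) (β : LinftyBdry Ω) {x y : V Ω} :
    (x, y) ∈ (wentzellOperator Ω β).graph ↔ ∃ h : L2Bdry Ω,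
      HasWeakLaplacian x.fn.fn y.fn.fn ∧ HasNormalDeriv x.fn h ∧
        y.bdry = -h - (β • x.bdry : L2Bdry Ω) := by
  have hform : (x, y) ∈ (wentzellOperator Ω β).graph ↔
      ∀ v, inner ℂ v x = inner ℂ (embedding Ω v) (perturbedEmbedding β x - embedding Ω y) :=
    HolomorphicSemigroup.mem_graph_formOperator_iff (ι := embedding Ω) (B := perturbedEmbedding β)
      (embedding_injective hΩ_open)
  have hh (h : L2Bdry Ω) : y.bdry = -h - (β • x.bdry : L2Bdry Ω) ↔
      h = -y.bdry - (β • x.bdry : L2Bdry Ω) := by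
    constructor <;> rintro hy <;> rw [hy] <;> abel
  simp only [hh, ← and_assoc, exists_eq_right]
  simp only [hform, inner_eq_inner_embedding_iff_greenIdentity]
  rw [hasWeakLaplacian_and_hasNormalDeriv_iff hΩ_open hΩ_bdd, ← forall_V_greenIdentity_iff]

theorem V.bdry_mem_Tr (x : V Ω) : x.bdry ∈ Tr x.fn := x.2

theorem V.toL2Sum_fst (x : V Ω) : x.toL2Sum.fst = x.fn.fn := by
  rw [V.toL2Sum, WithLp.toLp_fst]

theorem V.toL2Sum_snd (x : V Ω) : x.toL2Sum.snd = x.bdry := by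
  rw [V.toL2Sum, WithLp.toLp_snd]

theorem mem_partGraph_wentzellLaplacian_iff (hΩ : IsOpen Ω) (β : LinftyBdry Ω) {x y : V Ω} :
    (x, y) ∈ partGraph V.toL2Sum (wentzellLaplacian Ω β) ↔ ∃ h : L2Bdry Ω,
      HasWeakLaplacian x.fn.fn y.fn.fn ∧ HasNormalDeriv x.fn h ∧
        y.bdry = -h - (β • x.bdry : L2Bdry Ω) := by
  have hmem : (x, y) ∈ partGraph V.toL2Sum (wentzellLaplacian Ω β) ↔
      ∃ (u : H1 Ω) (h : L2Bdry Ω), u.fn = x.toL2Sum.fst ∧ x.toL2Sum.snd ∈ Tr u ∧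
        HasWeakLaplacian u.fn y.toL2Sum.fst ∧ HasNormalDeriv u h ∧
        y.toL2Sum.snd = -h - (β • x.toL2Sum.snd : L2Bdry Ω) := Iff.rfl
  simp only [hmem, V.toL2Sum_fst, V.toL2Sum_snd]
  constructor
  · rintro ⟨u, h, hu, -, hlap, hnormal, hy⟩
    obtain rfl : u = x.fn := H1.fn_injective hΩ hu
    exact ⟨h, hlap, hnormal, hy⟩
  · rintro ⟨h, hlap, hnormal, hy⟩
    exact ⟨x.fn, h, rfl, x.bdry_mem_Tr, hlap, hnormal, hy⟩

end WentzellOperator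

end

end Wentzell

theorem theorem5p1 (d : ℕ) (hd : 1 ≤ d) (Ω : Set (EuclideanSpace ℝ (Fin d)))
    (hΩ_open : IsOpen Ω) (hΩ_bdd : Bornology.IsBounded Ω)
    (hΓ : (Measure.euclideanHausdorffMeasure (d - 1) :
      Measure (EuclideanSpace ℝ (Fin d))) (frontier Ω) < ⊤)
    (β : Wentzell.LinftyBdry Ω) :
    ∃ A : Wentzell.V Ω →ₗ.[ℂ] Wentzell.V Ω,
      -- `A` is the part of `Δ^W` in `V`
      (A.graph : Set (Wentzell.V Ω × Wentzell.V Ω)) =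
        partGraph Wentzell.V.toL2Sum (Wentzell.wentzellLaplacian Ω β) ∧
      Semigroup.GeneratesHolomorphicC0Semigroup A ∧
      -- explicit description of the domain, with the Wentzell condition in the sense of traces
      (∀ x : Wentzell.V Ω, x ∈ A.domain ↔
        ∃ (f : Wentzell.H1 Ω) (h : Wentzell.L2Bdry Ω),
          Wentzell.HasWeakLaplacian x.fn.fn f.fn ∧ Wentzell.HasNormalDeriv x.fn h ∧
          -h - (β • x.bdry : Wentzell.L2Bdry Ω) ∈ Wentzell.Tr f) ∧
      -- explicit description of the action
      (∀ x : A.domain, ∃ h : Wentzell.L2Bdry Ω,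
        Wentzell.HasWeakLaplacian (x : Wentzell.V Ω).fn.fn (A x).fn.fn ∧
        Wentzell.HasNormalDeriv (x : Wentzell.V Ω).fn h ∧
        (A x).bdry = -h - (β • (x : Wentzell.V Ω).bdry : Wentzell.L2Bdry Ω) ∧
        -h - (β • (x : Wentzell.V Ω).bdry : Wentzell.L2Bdry Ω) ∈ Wentzell.Tr (A x).fn) := by
  have : IsFiniteMeasure (Wentzell.bdryMeasure Ω) := ⟨by rwa [Measure.restrict_apply_univ]⟩
  have hgraph (x y : Wentzell.V Ω) := Wentzell.mem_graph_wentzellOperator_iff hΩ_open hΩ_bdd β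
    (x := x) (y := y)
  refine ⟨Wentzell.wentzellOperator Ω β, ?_,
    Wentzell.generatesHolomorphicC0Semigroup_wentzellOperator hΩ_open β, fun x => ?_, fun x => ?_⟩
  · ext ⟨x, y⟩
    exact (hgraph x y).trans (Wentzell.mem_partGraph_wentzellLaplacian_iff hΩ_open β).symm
  · rw [LinearPMap.mem_domain_iff]
    constructor
    · rintro ⟨y, hy⟩
      obtain ⟨h, hlap, hnormal, hbdry⟩ := (hgraph x y).1 hy
      exact ⟨y.fn, h, hlap, hnormal, hbdry ▸ y.bdry_mem_Tr⟩
    · rintro ⟨f, h, hlap, hnormal, htr⟩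
      exact ⟨⟨WithLp.toLp 2 (f, _), htr⟩, (hgraph _ _).2 ⟨h, hlap, hnormal, rfl⟩⟩
  · obtain ⟨h, hlap, hnormal, hbdry⟩ := (hgraph _ _).1 (LinearPMap.mem_graph _ x)
    exact ⟨h, hlap, hnormal, hbdry, hbdry ▸ Wentzell.V.bdry_mem_Tr _⟩
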